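/- **Setting.** For a function $f$ that is Lipschitz near $x\in\mathbb R^N$, let $\partial f(x)=\mathrm{conv}\{\lim_k\nabla f(x_k): x_k\to x,\ f \text{ differentiable at } x_k\}$ be its Clarke subdifferential; its elements are the generalized gradients of $f$ at $x$. Let $P(w)$ be a combinatorial problem with parameter $w\in\mathcal W\subseteq\mathbb R^d$ that is phrased as an integer linear program (minimization over nonnegative integer vectors subject to linear constraints) having an optimal solution for every $w\in\mathcal W$; let $z^*(w)$ be its optimal objective value. Let $$LP(c,A,b)=\min\{c^Tu:\ u\ge 0,\ (Au)_i=b_i\ (i\notin I),\ (Au)_i\ge b_i\ (i\in I)\},\qquad A\in\mathbb R^{m\times n},\ I\subseteq\{1,\dots,m\}$$ (standard form: $I=\emptyset$), with dual $\max\{b^Tv:\ A^Tv\le c,\ v_i\ge0\ (i\in I)\}$. An LP formulation of $P$ with data $c(w),A(w),b(w)$ is called *equivalent* to $P$ if $LP(c(w),A(w),b(w))=z^*(w)$ for every $w\in\mathcal W$, for instance the ideal formulation, whose feasible set is the convex hull of the feasible integer points. $U^*$ and $V^*$ denote the sets of optimal primal and dual solutions of the LP formulation at the parameter $w$ under consideration.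 All functions of $w$ below are assumed locally Lipschitz on the interior of $\mathcal W$. **Theorem 1.** Let $w$ be in the interior of $\mathcal W$. 1. (Primal $\partial$-efficient: $P$ has an equivalent LP formulation in which only $c=c(w)$ depends on $w$.) Then $z^*$ is Lipschitz near $w$, $\partial z^*(w)\neq\emptyset$ and $\partial z^*(w)\subseteq\mathrm{conv}\bigcup_{u\in U^*}\partial\langle c(\cdot),u\rangle(w)$. If moreover $c$ is strictly differentiable at $w$ (for instance continuously differentiable near $w$), then $\partial z^*(w)=\{(\partial c/\partial w)^Tu:\ u\in U^*\}$, where $\partial c/\partial w$ is the Jacobian matrix. Each of these vectors is computed from $u$ and the Jacobian, by one program depending only on $d$ and $n$, with at most $2dn+1$ arithmetic operations. 2. (Dual $\partial$-efficient: only $b=b(w)$ depends on $w$.) Then $z^*$ is Lipschitz near $w$, $\partial z^*(w)\neq\emptyset$ and $\partial z^*(w)\subseteq\mathrm{conv}\bigcup_{v\in V^*}\partial\langle b(\cdot),v\rangle(w)$. If moreover $b$ is strictly differentiable at $w$, then $\partial z^*(w)=\{(\partial b/\partial w)^Tv:\ v\in V^*\}$, each vector being computed from $v$ and the Jacobian,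 by one program depending only on $d$ and $m$, with at most $2dm+1$ arithmetic operations. 3. (Primal-dual $\partial$-efficient: $c(w),A(w),b(w)$ may all depend on $w$.) Assume that the optimal value of the LP is finite at $(c(w),A(w),b(w))$ and in some neighborhood of that point in the space of all data $(c,A,b)$. Then the function $X\mapsto LP(c(w),X,b(w))$ is Lipschitz near $A(w)$, and its set of generalized gradients at $A(w)$ (for the inner product $\sum_{ij}X_{ij}Y_{ij}$) is nonempty, is contained in $\mathrm{conv}\{-vu^T:\ v\in V^*,\ u\in U^*\}$, and is equal to this convex hull when the LP is in standard form ($I=\emptyset$). Each matrix $-vu^T$ is computed from $v$ and $u$, by one program depending only on $m$ and $n$, with at most $2mn+1$ arithmetic operations. Furthermore $z^*$ is Lipschitz near $w$, $\partial z^*(w)\ne\emptyset$, and $$\partial z^*(w)\subseteq\mathrm{conv}\bigcup_{u\in U^*,\,v\in V^*}\partial\bigl(c(\cdot)^Tu+b(\cdot)^Tv-v^TA(\cdot)u\bigr)(w);$$ if $c,A,b$ are strictly differentiable at $w$, the set on the right may be replaced by the convex hull of the gradients at $w$ of the functions $x\mapsto c(x)^Tu+b(x)^Tv-v^TA(x)u$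 with $u\in U^*$, $v\in V^*$. (The numbers $d$ of parameters, $n$ of variables and $m$ of constraints are arbitrary. The result holds in particular for problems solvable in polynomial time, but polynomial-time solvability is not needed for it.) -/

import Mathlib

open scoped Topology

/-- `ℝⁿ` with the Euclidean inner product. -/
abbrev Vec (n : ℕ) : Type := EuclideanSpace ℝ (Fin n)

/-- Real `m × n` matrices with the Frobenius inner product `∑ᵢⱼ Aᵢⱼ Bᵢⱼ`. -/
abbrev Mat (m n : ℕ) : Type := EuclideanSpace ℝ (Fin m × Fin n)

/-! ### Generalized gradients -/

/-- `f` is Lipschitz on some neighbourhood of `x`. -/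
def LipschitzNear {E F : Type*} [PseudoEMetricSpace E] [PseudoEMetricSpace F]
    (f : E → F) (x : E) : Prop :=
  ∃ K : NNReal, ∃ s ∈ 𝓝 x, LipschitzOnWith K f s

/-- The Clarke subdifferential: the convex hull of all limits of gradients `∇ f (x_k)` along
sequences `x_k → x` of points of differentiability. -/
noncomputable def clarke {E : Type*} [NormedAddCommGroup E] [InnerProductSpace ℝ E]
    [CompleteSpace E] (f : E → ℝ) (x : E) : Set E :=
  convexHull ℝ {g : E | ∃ s : ℕ → E, Filter.Tendsto s Filter.atTop (𝓝 x) ∧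
    (∀ k, DifferentiableAt ℝ f (s k)) ∧
    Filter.Tendsto (fun k => gradient f (s k)) Filter.atTop (𝓝 g)}

/-! ### Linear and integer linear programs -/

/-- The polyhedron `u ≥ 0`, `(A u)ᵢ ≥ bᵢ` for `i ∈ I` and `(A u)ᵢ = bᵢ` for `i ∉ I`.
The standard form `A u = b`, `u ≥ 0` is `I = ∅`. -/
def lpFeasible {m n : ℕ} (I : Set (Fin m)) (A : Mat m n) (b : Vec m) : Set (Vec n) :=
  {u | (∀ j, 0 ≤ u j) ∧
    (∀ i ∈ I, b i ≤ ∑ j, A (i, j) * u j) ∧ (∀ i ∉ I, ∑ j, A (i, j) * u j = b i)}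

/-- The integer points of the polyhedron: the feasible set of the integer linear program. -/
def ilpFeasible {m n : ℕ} (I : Set (Fin m)) (A : Mat m n) (b : Vec m) : Set (Vec n) :=
  {u | u ∈ lpFeasible I A b ∧ ∀ j, ∃ k : ℤ, u j = (k : ℝ)}

/-- The feasible set of the dual program `max bᵀ v` subject to `Aᵀ v ≤ c` and `vᵢ ≥ 0`
for `i ∈ I`. -/
def dualFeasible {m n : ℕ} (I : Set (Fin m)) (A : Mat m n) (c : Vec n) : Set (Vec m) :=
  {v | (∀ i ∈ I, 0 ≤ v i) ∧ ∀ j, ∑ i, A (i, j) * v i ≤ c j}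

/-- `z` is the (attained) optimal value of `min cᵀ u` over `u ∈ S`. -/
def IsOptimalValue {n : ℕ} (S : Set (Vec n)) (c : Vec n) (z : ℝ) : Prop :=
  IsLeast ((fun u : Vec n => inner ℝ c u) '' S) z

/-- The set `U*` of optimal solutions of the linear program. -/
def primalSolutions {m n : ℕ} (I : Set (Fin m)) (c : Vec n) (A : Mat m n) (b : Vec m) :
    Set (Vec n) :=
  {u | u ∈ lpFeasible I A b ∧ ∀ u' ∈ lpFeasible I A b, inner ℝ c u ≤ inner ℝ c u'}

/-- The set `V*` of optimal solutions of the dual linear program. -/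
def dualSolutions {m n : ℕ} (I : Set (Fin m)) (c : Vec n) (A : Mat m n) (b : Vec m) :
    Set (Vec m) :=
  {v | v ∈ dualFeasible I A c ∧ ∀ v' ∈ dualFeasible I A c, inner ℝ b v' ≤ inner ℝ b v}

/-- The linear program is feasible and bounded, that is, its optimal value is finite. -/
def LPFinite {m n : ℕ} (I : Set (Fin m)) (c : Vec n) (A : Mat m n) (b : Vec m) : Prop :=
  (lpFeasible I A b).Nonempty ∧
    BddBelow ((fun u : Vec n => inner ℝ c u) '' lpFeasible I A b)

/-- The optimal value is finite at `(c, A, b)` and at all data close to `(c, A, b)`. -/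
def LPStable {m n : ℕ} (I : Set (Fin m)) (c : Vec n) (A : Mat m n) (b : Vec m) : Prop :=
  ∀ᶠ q : Vec n × Mat m n × Vec m in 𝓝 (c, A, b), LPFinite I q.1 q.2.1 q.2.2

/-- The optimal value of the linear program; meaningful where `LPFinite` holds. -/
noncomputable def lpValue {m n : ℕ} (I : Set (Fin m)) (c : Vec n) (A : Mat m n) (b : Vec m) :
    ℝ :=
  sInf ((fun u : Vec n => inner ℝ c u) '' lpFeasible I A b)

/-- The matrix `- v uᵀ`. -/
noncomputable def negOuter {m n : ℕ} (v : Vec m) (u : Vec n) : Mat m n :=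
  WithLp.toLp 2 (fun p : Fin m × Fin n => -(v p.1 * u p.2))

/-- `cᵀ u + bᵀ v - vᵀ A u`. -/
noncomputable def lagrangian {m n : ℕ} (c : Vec n) (A : Mat m n) (b : Vec m)
    (u : Vec n) (v : Vec m) : ℝ :=
  inner ℝ c u + inner ℝ b v - ∑ i, ∑ j, v i * A (i, j) * u j

/-! ### Combinatorial problems -/

/-- A combinatorial problem with parameter `w` in a domain `W ⊆ ℝᵈ`, phrased as an integer
linear program all of whose data may depend on `w`, and which has an optimal solution for
every `w ∈ W`. -/
structure CombinatorialProblem (d : ℕ) where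
  /-- the parameter domain -/
  W : Set (Vec d)
  /-- the number of integer variables -/
  numVars : ℕ
  /-- the number of constraints -/
  numCons : ℕ
  /-- the constraints that are inequalities -/
  ineq : Set (Fin numCons)
  /-- the cost vector -/
  cost : Vec d → Vec numVars
  /-- the constraint matrix -/
  mat : Vec d → Mat numCons numVars
  /-- the right-hand side -/
  rhs : Vec d → Vec numCons
  solvable : ∀ w ∈ W, ∃ z, IsOptimalValue (ilpFeasible ineq (mat w) (rhs w)) (cost w) z

/-- The optimal objective value `z*(w)` of the problem, for `w ∈ W`. -/
noncomputable def CombinatorialProblem.value {d : ℕ} (P : CombinatorialProblem d)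
    (w : Vec d) : ℝ :=
  sInf ((fun u : Vec P.numVars => inner ℝ (P.cost w) u) ''
    ilpFeasible P.ineq (P.mat w) (P.rhs w))

/-- `LP(c(w), A(w), b(w))` is equivalent to the problem: for every parameter in the domain it
has the same optimal value. -/
def CombinatorialProblem.EquivalentLP {d m n : ℕ} (P : CombinatorialProblem d)
    (I : Set (Fin m)) (c : Vec d → Vec n) (A : Vec d → Mat m n) (b : Vec d → Vec m) : Prop :=
  ∀ w ∈ P.W, IsOptimalValue (lpFeasible I (A w) (b w)) (c w) (P.value w)

/-- `LP(c(w), A(w), b(w))` is an ideal formulation: it has the cost vector of the integer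
program, and its feasible set is the convex hull of the feasible integer points. -/
def CombinatorialProblem.IdealLP {d m : ℕ} (P : CombinatorialProblem d)
    (I : Set (Fin m)) (c : Vec d → Vec P.numVars) (A : Vec d → Mat m P.numVars)
    (b : Vec d → Vec m) : Prop :=
  ∀ w ∈ P.W, c w = P.cost w ∧
    lpFeasible I (A w) (b w) = convexHull ℝ (ilpFeasible P.ineq (P.mat w) (P.rhs w))

/-- Ideal formulations are equivalent to the problem. -/
theorem CombinatorialProblem.IdealLP.equivalentLP {d m : ℕ} {P : CombinatorialProblem d}
    {I : Set (Fin m)} {c : Vec d → Vec P.numVars} {A : Vec d → Mat m P.numVars}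
    {b : Vec d → Vec m} (h : P.IdealLP I c A b) : P.EquivalentLP I c A b := by
  intro w hw
  obtain ⟨z, hz⟩ := P.solvable w hw
  obtain ⟨hc, hf⟩ := h w hw
  have hv : P.value w = z := hz.csInf_eq
  rw [hv, hf, hc]
  obtain ⟨⟨u, hu, huz⟩, hlow⟩ := hz
  refine ⟨⟨u, subset_convexHull ℝ _ hu, huz⟩, ?_⟩
  rintro _ ⟨x, hx, rfl⟩
  have hconv : Convex ℝ {x : Vec P.numVars | z ≤ inner ℝ (P.cost w) x} :=
    convex_halfSpace_ge (f := fun x => inner ℝ (P.cost w) x)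
      ⟨fun x y => inner_add_right _ _ _, fun a x => real_inner_smul_right _ _ _⟩ z
  exact convexHull_min (fun y hy => hlow ⟨y, hy, rfl⟩) hconv hx

/-- Primal `∂`-efficiency through `LP(c(w), A, b)`: the parameter enters only the cost vector,
through a function having generalized derivatives (locally Lipschitz). -/
structure PrimalEfficient {d m n : ℕ} (P : CombinatorialProblem d) (I : Set (Fin m))
    (c : Vec d → Vec n) (A : Mat m n) (b : Vec m) : Prop where
  equivalent : P.EquivalentLP I c (fun _ => A) (fun _ => b)
  cost_lipschitz : ∀ w ∈ interior P.W, LipschitzNear c w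

/-- Dual `∂`-efficiency through `LP(c, A, b(w))`: the parameter enters only the right-hand
side. -/
structure DualEfficient {d m n : ℕ} (P : CombinatorialProblem d) (I : Set (Fin m))
    (c : Vec n) (A : Mat m n) (b : Vec d → Vec m) : Prop where
  equivalent : P.EquivalentLP I (fun _ => c) (fun _ => A) b
  rhs_lipschitz : ∀ w ∈ interior P.W, LipschitzNear b w

/-- Primal-dual `∂`-efficiency through `LP(c(w), A(w), b(w))`. -/
structure PrimalDualEfficient {d m n : ℕ} (P : CombinatorialProblem d) (I : Set (Fin m))
    (c : Vec d → Vec n) (A : Vec d → Mat m n) (b : Vec d → Vec m) : Prop where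
  equivalent : P.EquivalentLP I c A b
  cost_lipschitz : ∀ w ∈ interior P.W, LipschitzNear c w
  mat_lipschitz : ∀ w ∈ interior P.W, LipschitzNear A w
  rhs_lipschitz : ∀ w ∈ interior P.W, LipschitzNear b w

/-! ### Arithmetic programs -/

/-- Straight-line arithmetic programs over `ℝ`. The registers are indexed by `ι`; each
operation writes its result to the new register `none : Option ι`; finally the registers
listed by the output instruction are returned, indexed by `κ`. -/
inductive ArithProgram (κ : Type) : Type → Type 1
  | output {ι : Type} (r : κ → ι) : ArithProgram κ ι
  | const {ι : Type} (a : ℝ) (next : ArithProgram κ (Option ι)) : ArithProgram κ ι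
  | add {ι : Type} (i j : ι) (next : ArithProgram κ (Option ι)) : ArithProgram κ ι
  | sub {ι : Type} (i j : ι) (next : ArithProgram κ (Option ι)) : ArithProgram κ ι
  | mul {ι : Type} (i j : ι) (next : ArithProgram κ (Option ι)) : ArithProgram κ ι

/-- The result of running a program on the register contents `x`. -/
def ArithProgram.eval {κ : Type} : {ι : Type} → ArithProgram κ ι → (ι → ℝ) → κ → ℝ
  | _, .output r, x => fun k => x (r k)
  | _, .const a next, x => next.eval (fun o => o.elim a x)
  | _, .add i j next, x => next.eval (fun o => o.elim (x i + x j) x)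
  | _, .sub i j next, x => next.eval (fun o => o.elim (x i - x j) x)
  | _, .mul i j next, x => next.eval (fun o => o.elim (x i * x j) x)

/-- The running time: the number of operations. -/
def ArithProgram.time {κ : Type} : {ι : Type} → ArithProgram κ ι → ℕ
  | _, .output _ => 0
  | _, .const _ next => next.time + 1
  | _, .add _ _ next => next.time + 1
  | _, .sub _ _ next => next.time + 1
  | _, .mul _ _ next => next.time + 1

/-- The entries `∂ fᵢ / ∂ w_k` of the Jacobian matrix of a derivative. -/
noncomputable def jacobian {d n : ℕ} (f' : Vec d →L[ℝ] Vec n) : Fin n × Fin d → ℝ :=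
  fun p => f' (EuclideanSpace.single p.2 1) p.1

/-! The tool is a two-sided description of the Clarke subdifferential by its support function. If
`⟪g, h⟫ ≤ S` for all generalized gradients `g` at `w`, then increments over `t • h` near `w` are at
most `t (S + ε)` (`eventually_sub_le_of_clarke`, through a mean value inequality obtained by
averaging over small translations and Rademacher's theorem). Conversely, such increment bounds
control `⟪g, h⟫` (`inner_le_of_mem_clarke`). This yields `clarke_envelope`: increments dominated, up
to a small error, by those of functions `⟪q, θ⟫` with `θ` in a compact set confine the
subdifferential to the convex hull of theirs.

If only the cost or only the right-hand side varies, the primal or the dual feasible set is a fixed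
polyhedron, and the value is locally a minimum or maximum of finitely many functions `⟪q, θ⟫`: one
`θ` per set of active constraints is enough. The envelope theorem gives the inclusion. Under strict
differentiability every optimal `θ` gives a function touching the value from one side, so its
gradient is a generalized gradient; as the optimal set is convex, so is its image under the
transposed Jacobian, and no hull is needed.

If all data vary, stability excludes recession directions of optimal pairs, so these pairs form a
compact, upper semicontinuous set (`LPStable.exists_subseq`). By weak duality the value grows at
most as the Lagrangian does at an old primal and a new dual solution (`lpValue_sub_le`). The
Lagrangian is linear in the data, so the envelope theorem applies again.

For equality in standard form, a pair `(u, v)` of uniquely exposed solutions is singled out by a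
direction `D`: the outer products of the solutions for `A + s • D` tend to that of `(u, v)` as `s`
decreases to `0`, and the closed graph of the subdifferential puts `negOuter v u` into it. Exposed
pairs approximate the support function of all outer products, which gives the rest. -/

/-! ### Limiting gradients of Lipschitz functions and a mean value inequality. -/

section ClarkeCalculus

open Filter Metric

/-- In finite dimension the convex hull of a compact set is compact. -/
theorem IsCompact.convexHull_of_finiteDimensional {E : Type*} [NormedAddCommGroup E]
    [NormedSpace ℝ E] [FiniteDimensional ℝ E] {s : Set E} (hs : IsCompact s) :
    IsCompact (convexHull ℝ s) := by
  rcases s.eq_empty_or_nonempty with rfl | ⟨x₀, hx₀⟩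
  · simp
  set N := Module.finrank ℝ E + 1
  -- Carathéodory: `dim + 1` points suffice, so the hull is a continuous image of a compact set.
  have hK : IsCompact (stdSimplex ℝ (Fin N) ×ˢ Set.univ.pi fun _ : Fin N => s) :=
    (isCompact_stdSimplex ℝ (Fin N)).prod (isCompact_univ_pi fun _ => hs)
  have hcont : Continuous fun p : (Fin N → ℝ) × (Fin N → E) => ∑ i, p.1 i • p.2 i := by fun_prop
  convert hK.image hcont using 1
  apply Set.Subset.antisymm
  · intro x hx
    obtain ⟨ι, _, z, w, hz, hai, hw, hw1, rfl⟩ := eq_pos_convex_span_of_mem_convexHull hx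
    have hcard : Fintype.card ι ≤ Fintype.card (Fin N) := by
      rw [Fintype.card_fin]
      exact hai.card_le_finrank_succ.trans (Nat.succ_le_succ (Submodule.finrank_le _))
    obtain ⟨e⟩ := Function.Embedding.nonempty_of_card_le hcard
    -- Unused slots get weight `0` and the dummy point `x₀`.
    refine ⟨(Function.extend e w 0, Function.extend e z fun _ => x₀), ⟨⟨fun k => ?_, ?_⟩, ?_⟩, ?_⟩
    · by_cases hk : ∃ i, e i = k
      · obtain ⟨i, rfl⟩ := hk
        simpa [e.injective.extend_apply] using (hw i).le
      · simp [Function.extend_apply' _ _ _ hk]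
    · rw [← hw1]
      refine (Fintype.sum_of_injective e e.injective _ _ (fun k hk => ?_) fun i => ?_).symm
      · exact Function.extend_apply' _ _ _ hk
      · exact (e.injective.extend_apply _ _ _).symm
    · intro k _
      by_cases hk : ∃ i, e i = k
      · obtain ⟨i, rfl⟩ := hk
        simpa [e.injective.extend_apply] using hz ⟨i, rfl⟩
      · simpa [Function.extend_apply' _ _ _ hk] using hx₀
    · refine (Fintype.sum_of_injective e e.injective _ _ (fun k hk => ?_) fun i => ?_).symm
      · simp [Function.extend_apply' _ _ _ hk]
      · simp [e.injective.extend_apply]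
  · rintro _ ⟨⟨w, z⟩, ⟨⟨hw0, hw1⟩, hz⟩, rfl⟩
    exact (convex_convexHull ℝ s).sum_mem (fun i _ => hw0 i) hw1
      fun i _ => subset_convexHull ℝ s (hz i (Set.mem_univ i))

theorem LipschitzNear.exists_ball {E F : Type*} [PseudoMetricSpace E] [PseudoEMetricSpace F]
    {f : E → F} {w : E} (h : LipschitzNear f w) :
    ∃ K : NNReal, ∃ r > 0, LipschitzOnWith K f (ball w r) := by
  obtain ⟨K, s, hs, hK⟩ := h
  obtain ⟨r, hr, hrs⟩ := Metric.mem_nhds_iff.1 hs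
  exact ⟨K, r, hr, hK.mono hrs⟩

variable {E : Type*} [NormedAddCommGroup E] [InnerProductSpace ℝ E] [CompleteSpace E]

/-- The limits of gradients whose convex hull is the Clarke subdifferential. -/
def limitingGradients (f : E → ℝ) (x : E) : Set E :=
  {g : E | ∃ s : ℕ → E, Tendsto s atTop (𝓝 x) ∧ (∀ k, DifferentiableAt ℝ f (s k)) ∧
    Tendsto (fun k => gradient f (s k)) atTop (𝓝 g)}

theorem limitingGradients_subset_clarke (f : E → ℝ) (x : E) :
    limitingGradients f x ⊆ clarke f x := subset_convexHull ℝ _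

theorem inner_gradient (f : E → ℝ) (x h : E) : inner ℝ (gradient f x) h = fderiv ℝ f x h := by
  simp [gradient]

theorem norm_gradient_le {f : E → ℝ} {s : Set E} {K : NNReal} {x : E} (hs : s ∈ 𝓝 x)
    (hf : LipschitzOnWith K f s) : ‖gradient f x‖ ≤ K := by
  simpa [gradient] using norm_fderiv_le_of_lipschitzOn ℝ hs hf

theorem norm_le_of_mem_limitingGradients {f : E → ℝ} {s : Set E} {K : NNReal} {w g : E}
    (hs : s ∈ 𝓝 w) (hf : LipschitzOnWith K f s) (hg : g ∈ limitingGradients f w) : ‖g‖ ≤ K := by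
  obtain ⟨y, hy, -, hlim⟩ := hg
  refine le_of_tendsto hlim.norm ?_
  filter_upwards [hy.eventually (eventually_mem_nhds_iff.2 hs)] with k hk
  exact norm_gradient_le hk hf

/-- The set is a slice of the closure of the graph of the gradient over the points of
differentiability. -/
theorem isClosed_limitingGradients (f : E → ℝ) (w : E) : IsClosed (limitingGradients f w) := by
  have h : limitingGradients f w = (fun g => (w, g)) ⁻¹'
      closure ((fun y => (y, gradient f y)) '' {y | DifferentiableAt ℝ f y}) := by
    ext g
    rw [Set.mem_preimage, mem_closure_iff_seq_limit]
    constructor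
    · rintro ⟨y, hy, hd, hg⟩
      exact ⟨fun k => (y k, gradient f (y k)), fun k => ⟨y k, hd k, rfl⟩, hy.prodMk_nhds hg⟩
    · rintro ⟨p, hp, hlim⟩
      choose y hd hy using hp
      rw [nhds_prod_eq, tendsto_prod_iff'] at hlim
      refine ⟨y, ?_, hd, ?_⟩
      · exact hlim.1.congr fun k => by rw [← hy k]
      · exact hlim.2.congr fun k => by rw [← hy k]
  rw [h]
  exact isClosed_closure.preimage (by fun_prop)

theorem norm_le_of_mem_clarke {f : E → ℝ} {s : Set E} {K : NNReal} {w g : E}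
    (hs : s ∈ 𝓝 w) (hf : LipschitzOnWith K f s) (hg : g ∈ clarke f w) : ‖g‖ ≤ K := by
  have : clarke f w ⊆ closedBall 0 K :=
    convexHull_min (fun g hg => by simpa using norm_le_of_mem_limitingGradients hs hf hg)
      (convex_closedBall _ _)
  simpa using this hg

variable [FiniteDimensional ℝ E]

theorem isCompact_limitingGradients {f : E → ℝ} {w : E} (hf : LipschitzNear f w) :
    IsCompact (limitingGradients f w) := by
  obtain ⟨K, s, hs, hK⟩ := hf
  refine (isCompact_closedBall (0 : E) K).of_isClosed_subset (isClosed_limitingGradients f w) ?_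
  intro g hg
  simpa using norm_le_of_mem_limitingGradients hs hK hg

theorem isCompact_clarke {f : E → ℝ} {w : E} (hf : LipschitzNear f w) :
    IsCompact (clarke f w) :=
  (isCompact_limitingGradients hf).convexHull_of_finiteDimensional

/-- A sequence of points of differentiability tending to `w` has a subsequence along which the
gradients converge. -/
theorem exists_mem_limitingGradients {f : E → ℝ} {w : E} (hf : LipschitzNear f w) {y : ℕ → E}
    (hy : Tendsto y atTop (𝓝 w)) (hd : ∀ k, DifferentiableAt ℝ f (y k)) :
    ∃ g ∈ limitingGradients f w, ∃ φ : ℕ → ℕ, StrictMono φ ∧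
      Tendsto (fun k => gradient f (y (φ k))) atTop (𝓝 g) := by
  obtain ⟨K, s, hs, hK⟩ := hf
  have hb : ∃ᶠ k in atTop, gradient f (y k) ∈ closedBall (0 : E) K := by
    refine Eventually.frequently ?_
    filter_upwards [hy.eventually (eventually_mem_nhds_iff.2 hs)] with k hk
    simpa using norm_gradient_le hk hK
  obtain ⟨g, -, φ, hφ, hg⟩ := (isCompact_closedBall (0 : E) K).tendsto_subseq' hb
  exact ⟨g, ⟨y ∘ φ, hy.comp hφ.tendsto_atTop, fun k => hd _, hg⟩, φ, hφ, hg⟩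

/-- Otherwise bad points tend to `w`; their gradients are bounded, hence subconverge, and the limit
is a limiting gradient. -/
theorem eventually_gradient_mem_thickening {f : E → ℝ} {w : E} (hf : LipschitzNear f w) {ε : ℝ}
    (hε : 0 < ε) : ∀ᶠ y in 𝓝 w, DifferentiableAt ℝ f y →
      gradient f y ∈ thickening ε (limitingGradients f w) := by
  by_contra hcon
  obtain ⟨y, hy, hyk⟩ := exists_seq_forall_of_frequently (not_eventually.1 hcon)
  push Not at hyk
  obtain ⟨g, hg, φ, -, hlim⟩ := exists_mem_limitingGradients hf hy fun k => (hyk k).1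
  have := hlim.eventually (isOpen_thickening.mem_nhds
    (self_subset_thickening hε (limitingGradients f w) hg))
  obtain ⟨k, hk⟩ := this.exists
  exact (hyk (φ k)).2 hk

-- By Rademacher's theorem no ball around `w` misses the points of differentiability.
open MeasureTheory in
theorem limitingGradients_nonempty {f : E → ℝ} {w : E} (hf : LipschitzNear f w) :
    (limitingGradients f w).Nonempty := by
  obtain ⟨K, r, hr, hK⟩ := hf.exists_ball
  let _ : MeasurableSpace E := borel E
  have : BorelSpace E := ⟨rfl⟩
  have hae := hK.ae_differentiableWithinAt_of_mem (μ := Measure.addHaar)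
  have hfreq : ∃ᶠ y in 𝓝 w, DifferentiableAt ℝ f y := by
    intro hcon
    obtain ⟨ρ, hρ, hsub⟩ := Metric.mem_nhds_iff.1 (hcon.and (ball_mem_nhds w hr))
    have hzero : Measure.addHaar (ball w ρ) = 0 := by
      refine measure_mono_null (fun y hy => ?_) hae
      obtain ⟨h1, h2⟩ := hsub hy
      intro h3
      exact h1 ((h3 h2).differentiableAt (isOpen_ball.mem_nhds h2))
    exact (measure_ball_pos Measure.addHaar w hρ).ne' hzero
  obtain ⟨y, hy, hyk⟩ := exists_seq_forall_of_frequently hfreq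
  obtain ⟨g, hg, -⟩ := exists_mem_limitingGradients hf hy hyk
  exact ⟨g, hg⟩

theorem clarke_nonempty {f : E → ℝ} {w : E} (hf : LipschitzNear f w) : (clarke f w).Nonempty :=
  (limitingGradients_nonempty hf).mono (limitingGradients_subset_clarke f w)

open MeasureTheory in
/-- A mean value inequality: it suffices to bound the derivative at the points of
differentiability. -/
theorem LipschitzOnWith.sub_le_of_inner_gradient_le {f : E → ℝ} {K : NNReal} {w : E} {r : ℝ}
    (hf : LipschitzOnWith K f (ball w r)) {x y : E} (hx : x ∈ ball w r) (hy : y ∈ ball w r)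
    {a : ℝ} (ha : ∀ z ∈ ball w r, DifferentiableAt ℝ f z → inner ℝ (gradient f z) (y - x) ≤ a) :
    f y - f x ≤ a := by
  let _ : MeasurableSpace E := borel E
  have : BorelSpace E := ⟨rfl⟩
  obtain ⟨g, hg, hfg⟩ := hf.extend_real
  set h := y - x with hh
  have hder : ∀ z ∈ ball w r, DifferentiableAt ℝ g z → fderiv ℝ g z h ≤ a := by
    intro z hz hd
    have heq : f =ᶠ[𝓝 z] g := hfg.eventuallyEq_of_mem (isOpen_ball.mem_nhds hz)
    have := ha z hz (hd.congr_of_eventuallyEq heq)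
    rwa [inner_gradient, heq.fderiv_eq] at this
  rw [hfg hx, hfg hy]
  refine le_of_forall_pos_le_add fun ε hε => ?_
  obtain ⟨ρ₁, hρ₁, hb₁⟩ := Metric.isOpen_iff.1 isOpen_ball x hx
  obtain ⟨ρ₂, hρ₂, hb₂⟩ := Metric.isOpen_iff.1 isOpen_ball y hy
  -- Translations by less than `δ` keep the segment inside the ball, and averaging over them changes
  -- the value at each endpoint by at most `K * δ`.
  obtain ⟨δ, hδ, hδ₁, hδ₂, hδε⟩ : ∃ δ > 0, δ ≤ ρ₁ ∧ δ ≤ ρ₂ ∧ 2 * (K * δ) ≤ ε := by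
    refine ⟨min (min ρ₁ ρ₂) (ε / (2 * (K + 1))), by positivity,
      (min_le_left _ _).trans (min_le_left _ _), (min_le_left _ _).trans (min_le_right _ _), ?_⟩
    have h1 : min (min ρ₁ ρ₂) (ε / (2 * (K + 1))) ≤ ε / (2 * (K + 1)) := min_le_right _ _
    have hK0 : (0 : ℝ) ≤ K := K.2
    calc 2 * (K * min (min ρ₁ ρ₂) (ε / (2 * (K + 1)))) ≤ 2 * ((K + 1) * (ε / (2 * (K + 1)))) := by
          gcongr
          linarith
      _ = ε := by field_simp
  -- The segment itself may miss every point of differentiability. Averaged over a ball of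
  -- translations, `g` becomes differentiable along it, and for each `t` only almost every translate
  -- matters.
  set μ : Measure E := Measure.addHaar.restrict (ball 0 δ)
  have : IsFiniteMeasure μ := ⟨by simpa [μ] using measure_ball_lt_top⟩
  set V : ℝ := μ.real Set.univ with hV
  have hVpos : 0 < V := by
    rw [hV, measureReal_def]
    refine ENNReal.toReal_pos ?_ (measure_ne_top _ _)
    simpa [μ] using (measure_ball_pos Measure.addHaar (0 : E) hδ).ne'
  have hball : ∀ t ∈ Set.Icc (0 : ℝ) 1, ∀ z ∈ ball (0 : E) δ, x + t • h + z ∈ ball w r := by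
    intro t ht z hz
    have hz' : ‖z‖ < δ := by simpa using hz
    have hx' : x + z ∈ ball w r := hb₁ (by simpa using hz'.trans_le hδ₁)
    have hy' : y + z ∈ ball w r := hb₂ (by simpa using hz'.trans_le hδ₂)
    have := convex_ball w r hx' hy' (sub_nonneg.2 ht.2) ht.1 (by ring)
    convert this using 1
    rw [hh]
    module
  have hint : ∀ v : E, Integrable (fun z => g (v + z)) μ := by
    intro v
    have hc : Continuous fun z => g (v + z) := hg.continuous.comp (by fun_prop)
    exact (hc.continuousOn.integrableOn_compact (isCompact_closedBall (0 : E) δ)).mono_set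
      ball_subset_closedBall
  have hderiv : ∀ t : ℝ, ∃ D, HasDerivAt (fun t : ℝ => ∫ z, g (x + t • h + z) ∂μ) D t ∧
      (t ∈ Set.Icc (0 : ℝ) 1 → D ≤ a * V) := by
    intro t
    have hlip : LipschitzWith K fun z => g (x + t • h + z) := by
      exact LipschitzWith.of_dist_le_mul fun z₁ z₂ => by
        simpa using hg.dist_le_mul (x + t • h + z₁) (x + t • h + z₂)
    have hae : ∀ᵐ z ∂μ, DifferentiableAt ℝ (fun z => g (x + t • h + z)) z :=
      ae_restrict_of_ae hlip.ae_differentiableAt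
    have key := hasDerivAt_integral_of_dominated_loc_of_lip (μ := μ) (𝕜 := ℝ) (x₀ := t)
      (F := fun t z => g (x + t • h + z)) (s := Set.univ) (bound := fun _ => K * ‖h‖)
      (F' := fun z => fderiv ℝ (fun z => g (x + t • h + z)) z h) Filter.univ_mem
      (Eventually.of_forall fun t => (hint _).aestronglyMeasurable) (hint _)
      (measurable_fderiv_apply_const ℝ _ h).aestronglyMeasurable
      (Eventually.of_forall fun z => ?_) (integrable_const _) ?_
    · refine ⟨_, key.2, fun ht => ?_⟩
      have : ∫ z, fderiv ℝ (fun z => g (x + t • h + z)) z h ∂μ ≤ ∫ _, a ∂μ := by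
        refine integral_mono_ae key.1 (integrable_const _) ?_
        filter_upwards [hae, ae_restrict_mem measurableSet_ball] with z hz hzb
        have h1 := (hasFDerivAt_comp_add_left (x + t • h)).1 hz.hasFDerivAt
        rw [← h1.fderiv]
        exact hder _ (hball t ht z hzb) h1.differentiableAt
      simpa [hV, mul_comm] using this
    · refine LipschitzOnWith.of_dist_le_mul fun t₁ _ t₂ _ => ?_
      refine (hg.dist_le_mul _ _).trans_eq ?_
      have : x + t₁ • h + z - (x + t₂ • h + z) = (t₁ - t₂) • h := by module
      rw [dist_eq_norm, this, norm_smul, Real.dist_eq, Real.norm_eq_abs]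
      have hKh : (0 : ℝ) ≤ K * ‖h‖ := by positivity
      rw [Real.coe_nnabs, abs_of_nonneg hKh]
      ring
    · filter_upwards [hae] with z hz
      have h1 : HasFDerivAt g (fderiv ℝ (fun z => g (x + t • h + z)) z) (x + t • h + z) :=
        (hasFDerivAt_comp_add_left (x + t • h)).1 hz.hasFDerivAt
      have h2 : HasDerivAt (fun t : ℝ => x + t • h + z) h t := by
        simpa using (((hasDerivAt_id t).smul_const h).const_add x).add_const z
      exact h1.comp_hasDerivAt t h2
  choose D hD hDle using hderiv
  have hmv := (convex_Icc (0 : ℝ) 1).image_sub_le_mul_sub_of_deriv_le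
    (fun t _ => (hD t).continuousAt.continuousWithinAt)
    (fun t _ => (hD t).differentiableAt.differentiableWithinAt)
    (C := a * V) (fun t ht => (hD t).deriv ▸ hDle t (interior_subset ht))
    0 (by simp) 1 (by simp) zero_le_one
  have hyx : x + (1 : ℝ) • h = y := by rw [hh]; module
  simp only [zero_smul, add_zero, hyx, sub_zero, mul_one] at hmv
  have hclose : ∀ v, |∫ z, g (v + z) ∂μ - g v * V| ≤ K * δ * V := by
    intro v
    have : ∫ z, g (v + z) ∂μ - g v * V = ∫ z, (g (v + z) - g v) ∂μ := by
      rw [integral_sub (hint v) (integrable_const _)]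
      simp [hV, mul_comm]
    rw [this]
    rw [← Real.norm_eq_abs]
    refine norm_integral_le_of_norm_le_const ?_
    filter_upwards [ae_restrict_mem measurableSet_ball] with z hz
    have hz' : ‖z‖ < δ := by simpa using hz
    have := hg.dist_le_mul (v + z) v
    rw [Real.dist_eq] at this
    simp only [dist_self_add_left] at this
    exact this.trans (mul_le_mul_of_nonneg_left hz'.le K.2)
  have h1 := abs_le.1 (hclose x)
  have h2 := abs_le.1 (hclose y)
  have h3 : (g y - g x) * V ≤ (a + ε) * V := by nlinarith
  exact le_of_mul_le_mul_right h3 hVpos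

end ClarkeCalculus

/-! ### Support functions of Clarke subdifferentials and the envelope theorem. -/

section ClarkeCalculus

open Filter Metric

variable {H : Type*} [NormedAddCommGroup H] [InnerProductSpace ℝ H]

theorem LipschitzOnWith.inner_const {X : Type*} [PseudoMetricSpace X] {q : X → H} {s : Set X}
    {K : NNReal} (hK : LipschitzOnWith K q s) (θ : H) :
    LipschitzOnWith (K * ‖θ‖₊) (fun x => inner ℝ (q x) θ) s := by
  refine LipschitzOnWith.of_dist_le_mul fun x hx y hy => ?_
  rw [Real.dist_eq, ← inner_sub_left]
  calc |inner ℝ (q x - q y) θ| ≤ ‖q x - q y‖ * ‖θ‖ := abs_real_inner_le_norm _ _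
    _ ≤ K * dist x y * ‖θ‖ := by
      gcongr
      rw [← dist_eq_norm]
      exact hK.dist_le_mul x hx y hy
    _ = _ := by push_cast; ring

theorem LipschitzNear.inner_const {X : Type*} [PseudoMetricSpace X] {q : X → H} {w : X}
    (hq : LipschitzNear q w) (θ : H) : LipschitzNear (fun x => inner ℝ (q x) θ) w :=
  let ⟨K, s, hs, hK⟩ := hq
  ⟨K * ‖θ‖₊, s, hs, hK.inner_const θ⟩

variable {E : Type*} [NormedAddCommGroup E] [InnerProductSpace ℝ E] [CompleteSpace E]

/-- Hahn–Banach separation. It reduces membership in a subdifferential, or in a compact hull of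
several, to directional estimates. -/
theorem mem_of_forall_inner_le {C : Set E} (hC : Convex ℝ C) (hcl : IsClosed C) {g : E}
    (h : ∀ (v : E) (S : ℝ), (∀ c ∈ C, inner ℝ c v ≤ S) → inner ℝ g v ≤ S) : g ∈ C := by
  by_contra hg
  obtain ⟨l, u, hlt, hgt⟩ := geometric_hahn_banach_closed_point hC hcl hg
  have hrep : ∀ x, inner ℝ x ((InnerProductSpace.toDual ℝ E).symm l) = l x := fun x => by
    rw [real_inner_comm]; simp
  refine absurd (h ((InnerProductSpace.toDual ℝ E).symm l) u fun c hc => ?_) ?_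
  · rw [hrep]
    exact (hlt c hc).le
  · rw [hrep]
    exact not_le.2 hgt

/-- A function whose difference quotients in the direction `h` are asymptotically at most `S` has
Clarke gradients `g` with `⟪g, h⟫ ≤ S`. -/
theorem inner_le_of_mem_clarke {f : E → ℝ} {w h g : E} {S : ℝ} (hg : g ∈ clarke f w)
    (hf : ∀ ε > 0, ∀ᶠ p : E × E in 𝓝 (w, w), ∀ t : ℝ, 0 ≤ t → p.2 - p.1 = t • h →
      f p.2 - f p.1 ≤ t * (S + ε)) : inner ℝ g h ≤ S := by
  suffices hsub : clarke f w ⊆ {g | inner ℝ g h ≤ S} from hsub hg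
  refine convexHull_min ?_ (convex_halfSpace_le (f := fun g : E => inner ℝ g h)
    ⟨fun x y => inner_add_left _ _ _, fun a x => real_inner_smul_left _ _ _⟩ S)
  rintro g ⟨y, hy, hd, hlim⟩
  change inner ℝ g h ≤ S
  refine le_of_forall_pos_le_add fun ε hε => ?_
  refine le_of_tendsto (hlim.inner tendsto_const_nhds) ?_
  -- The bound also holds around `(y k, y k)` for large `k`, so it passes to the derivative there.
  have hev := (hf ε hε).eventually_nhds
  filter_upwards [(hy.prodMk_nhds hy).eventually hev] with k hk
  rw [inner_gradient]
  have hline : HasDerivAt (fun t : ℝ => f (y k + t • h)) (fderiv ℝ f (y k) h) 0 :=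
    (hd k).hasFDerivAt.hasLineDerivAt h
  have hslope := hline.tendsto_slope_zero_right
  refine le_of_tendsto hslope ?_
  have htend : Tendsto (fun t : ℝ => (y k, y k + t • h)) (𝓝[>] 0) (𝓝 (y k, y k)) := by
    have : Continuous fun t : ℝ => (y k, y k + t • h) := by fun_prop
    simpa using (this.tendsto 0).mono_left nhdsWithin_le_nhds
  filter_upwards [htend.eventually hk, self_mem_nhdsWithin] with t ht ht0
  have ht0' : (0 : ℝ) < t := ht0
  have := ht t ht0'.le (by simp)
  simp only [zero_add, zero_smul, add_zero, smul_eq_mul]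
  rw [inv_mul_le_iff₀ ht0']
  exact this

/-- The Clarke subdifferential at a point of strict differentiability is at most the gradient. -/
theorem clarke_subset_of_hasStrictFDerivAt {f : E → ℝ} {w g : E}
    (hf : HasStrictFDerivAt f (InnerProductSpace.toDual ℝ E g) w) : clarke f w ⊆ {g} := by
  intro g' hg'
  have key : ∀ h : E, inner ℝ g' h ≤ inner ℝ g h := by
    intro h
    refine inner_le_of_mem_clarke hg' fun ε hε => ?_
    have hc : 0 < ε / (‖h‖ + 1) := by positivity
    have hev := hf.isLittleO.def hc
    have hswap : Tendsto (fun p : E × E => (p.2, p.1)) (𝓝 (w, w)) (𝓝 (w, w)) :=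
      (continuous_swap.tendsto (w, w))
    filter_upwards [hswap.eventually hev] with p hp t ht hpt
    rw [hpt] at hp
    have h1 := (le_abs_self _).trans hp
    rw [InnerProductSpace.toDual_apply_apply, real_inner_smul_right, norm_smul,
      Real.norm_of_nonneg ht] at h1
    have h2 : ε / (‖h‖ + 1) * (t * ‖h‖) ≤ t * ε := by
      rw [div_mul_eq_mul_div, div_le_iff₀ (by positivity)]
      nlinarith [mul_nonneg ht hε.le, norm_nonneg h]
    linarith
  have h0 := key (g' - g)
  have h1 : inner ℝ (g' - g) (g' - g) ≤ 0 := by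
    rw [inner_sub_left]; linarith
  rw [Set.mem_singleton_iff, ← sub_eq_zero]
  exact inner_self_eq_zero.1 (le_antisymm h1 real_inner_self_nonneg)

variable [FiniteDimensional ℝ E]

/-- The difference quotients in the direction `h` are asymptotically bounded by the support
function of the Clarke subdifferential. -/
theorem eventually_sub_le_of_clarke {f : E → ℝ} {w h : E} {S : ℝ} (hf : LipschitzNear f w)
    (hS : ∀ g ∈ clarke f w, inner ℝ g h ≤ S) {ε : ℝ} (hε : 0 < ε) :
    ∀ᶠ p : E × E in 𝓝 (w, w), ∀ t : ℝ, 0 ≤ t → p.2 - p.1 = t • h →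
      f p.2 - f p.1 ≤ t * (S + ε) := by
  obtain ⟨K, r, hr, hK⟩ := hf.exists_ball
  have hc : 0 < ε / (‖h‖ + 1) := by positivity
  obtain ⟨ρ, hρ, hsub⟩ := Metric.mem_nhds_iff.1 ((eventually_gradient_mem_thickening hf hc).and
    (ball_mem_nhds w hr))
  have hK' : LipschitzOnWith K f (ball w ρ) := hK.mono fun z hz => (hsub hz).2
  have hw := ball_mem_nhds w hρ
  filter_upwards [prod_mem_nhds hw hw] with p hp t ht hpt
  -- Gradients close to `w` are close to limiting gradients, whose inner products with `h` are at
  -- most `S`.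
  refine hK'.sub_le_of_inner_gradient_le hp.1 hp.2 fun z hz hd => ?_
  obtain ⟨g, hg, hdist⟩ := mem_thickening_iff.1 ((hsub hz).1 hd)
  rw [hpt, real_inner_smul_right]
  refine mul_le_mul_of_nonneg_left ?_ ht
  have h1 : inner ℝ (gradient f z - g) h ≤ ε := by
    refine (real_inner_le_norm _ _).trans ?_
    rw [← dist_eq_norm]
    calc dist (gradient f z) g * ‖h‖ ≤ ε / (‖h‖ + 1) * (‖h‖ + 1) := by gcongr; linarith
      _ = ε := by field_simp
  have h2 := hS g (limitingGradients_subset_clarke f w hg)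
  rw [inner_sub_left] at h1
  linarith

/-- The Clarke subdifferential has closed graph. -/
theorem mem_clarke_of_tendsto {f : E → ℝ} {w g : E} (hf : LipschitzNear f w) {x c : ℕ → E}
    (hx : Tendsto x atTop (𝓝 w)) (hc : Tendsto c atTop (𝓝 g)) (hmem : ∀ k, c k ∈ clarke f (x k)) :
    g ∈ clarke f w := by
  refine mem_of_forall_inner_le (convex_convexHull ℝ _) (isCompact_clarke hf).isClosed
    fun v S hS => ?_
  refine le_of_forall_pos_le_add fun ε hε => ?_
  refine le_of_tendsto (hc.inner tendsto_const_nhds) ?_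
  have hev := (eventually_sub_le_of_clarke hf hS hε).eventually_nhds
  filter_upwards [(hx.prodMk_nhds hx).eventually hev] with k hk
  refine inner_le_of_mem_clarke (hmem k) fun ε' hε' => ?_
  filter_upwards [hk] with p hp t ht hpt
  exact (hp t ht hpt).trans (mul_le_mul_of_nonneg_left (by linarith) ht)

/-- The gradient of a function touching `Z` from above is a generalized gradient of `Z`. -/
theorem mem_clarke_of_le {Z f : E → ℝ} {w g : E} (hZ : LipschitzNear Z w)
    (hf : HasFDerivAt f (InnerProductSpace.toDual ℝ E g) w) (hle : ∀ᶠ x in 𝓝 w, Z x ≤ f x)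
    (heq : Z w = f w) : g ∈ clarke Z w := by
  refine mem_of_forall_inner_le (convex_convexHull ℝ _) (isCompact_clarke hZ).isClosed
    fun h S hS => ?_
  refine le_of_forall_pos_le_add fun ε hε => ?_
  -- The step from `w - t • h` to `w` is used: there `Z` increases at least as much as `f`.
  have hline : HasDerivAt (fun t : ℝ => f (w + t • (-h))) (-inner ℝ g h) 0 := by
    have := hf.hasLineDerivAt (-h)
    rwa [InnerProductSpace.toDual_apply_apply, inner_neg_right] at this
  have hslope := hline.tendsto_slope_zero_right
  have hcont : Continuous fun t : ℝ => w + t • (-h) := by fun_prop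
  have hlim : Tendsto (fun t : ℝ => w + t • (-h)) (𝓝[>] 0) (𝓝 w) := by
    simpa using (hcont.tendsto 0).mono_left nhdsWithin_le_nhds
  have hev := eventually_sub_le_of_clarke hZ hS hε
  have key : -(S + ε) ≤ -inner ℝ g h := by
    refine ge_of_tendsto hslope ?_
    filter_upwards [hlim.eventually hle, (hlim.prodMk_nhds tendsto_const_nhds).eventually hev,
      self_mem_nhdsWithin] with t h1 h2 ht0
    have ht0' : (0 : ℝ) < t := ht0
    have h3 := h2 t ht0'.le (by simp)
    simp only [zero_add, zero_smul, add_zero, smul_eq_mul]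
    rw [le_inv_mul_iff₀ ht0']
    linarith
  linarith

/-- The gradient of a function touching `Z` from below is a generalized gradient of `Z`. -/
theorem mem_clarke_of_ge {Z f : E → ℝ} {w g : E} (hZ : LipschitzNear Z w)
    (hf : HasFDerivAt f (InnerProductSpace.toDual ℝ E g) w) (hle : ∀ᶠ x in 𝓝 w, f x ≤ Z x)
    (heq : Z w = f w) : g ∈ clarke Z w := by
  refine mem_of_forall_inner_le (convex_convexHull ℝ _) (isCompact_clarke hZ).isClosed
    fun h S hS => ?_
  refine le_of_forall_pos_le_add fun ε hε => ?_
  have hline : HasDerivAt (fun t : ℝ => f (w + t • h)) (inner ℝ g h) 0 := by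
    have := hf.hasLineDerivAt h
    rwa [InnerProductSpace.toDual_apply_apply] at this
  have hslope := hline.tendsto_slope_zero_right
  have hcont : Continuous fun t : ℝ => w + t • h := by fun_prop
  have hlim : Tendsto (fun t : ℝ => w + t • h) (𝓝[>] 0) (𝓝 w) := by
    simpa using (hcont.tendsto 0).mono_left nhdsWithin_le_nhds
  have hev := eventually_sub_le_of_clarke hZ hS hε
  refine le_of_tendsto hslope ?_
  filter_upwards [hlim.eventually hle, (Filter.Tendsto.prodMk_nhds tendsto_const_nhds
    hlim).eventually hev, self_mem_nhdsWithin] with t h1 h2 ht0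
  have ht0' : (0 : ℝ) < t := ht0
  have h3 := h2 t ht0'.le (by simp)
  simp only [zero_add, zero_smul, add_zero, smul_eq_mul]
  rw [inv_mul_le_iff₀ ht0']
  linarith

/-- Passing from `θ₀` to `θ` changes the increment by at most `t * K * ‖h‖ * ‖θ - θ₀‖`. This
uniformity in `θ` drives the compactness arguments below. -/
theorem eventually_inner_sub_le_of_clarke {q : E → H} {w h : E} {θ₀ : H} {S : ℝ}
    (hq : LipschitzNear q w) (hS : ∀ g ∈ clarke (fun x => inner ℝ (q x) θ₀) w, inner ℝ g h ≤ S)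
    {ε : ℝ} (hε : 0 < ε) :
    ∀ᶠ z : (E × E) × H in 𝓝 ((w, w), θ₀), ∀ t : ℝ, 0 ≤ t → z.1.2 - z.1.1 = t • h →
      inner ℝ (q z.1.2 - q z.1.1) z.2 ≤ t * (S + ε) := by
  have hev := eventually_sub_le_of_clarke (hq.inner_const θ₀) hS (half_pos hε)
  obtain ⟨K, s, hs, hK⟩ := hq
  have hc : 0 < ε / 2 / (K * ‖h‖ + 1) := by positivity
  rw [nhds_prod_eq]
  filter_upwards [(hev.and (prod_mem_nhds hs hs)).prod_mk (ball_mem_nhds θ₀ hc)]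
    with z hz t ht hzt
  obtain ⟨⟨h1, h2⟩, h3⟩ := hz
  have h4 := h1 t ht hzt
  have hd := hK.dist_le_mul _ h2.2 _ h2.1
  rw [dist_eq_norm, dist_eq_norm, hzt, norm_smul, Real.norm_of_nonneg ht] at hd
  have h5 : inner ℝ (q z.1.2 - q z.1.1) (z.2 - θ₀) ≤ t * (ε / 2) := by
    refine (real_inner_le_norm _ _).trans ?_
    have h3' : ‖z.2 - θ₀‖ ≤ ε / 2 / (K * ‖h‖ + 1) := by
      rw [← dist_eq_norm]; exact (mem_ball.1 h3).le
    calc ‖q z.1.2 - q z.1.1‖ * ‖z.2 - θ₀‖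
        ≤ (K * (t * ‖h‖)) * (ε / 2 / (K * ‖h‖ + 1)) := by gcongr
      _ = t * (ε / 2) * ((K * ‖h‖) / (K * ‖h‖ + 1)) := by field_simp
      _ ≤ t * (ε / 2) * 1 := by
        gcongr
        rw [div_le_one (by positivity)]
        linarith
      _ = t * (ε / 2) := mul_one _
  rw [inner_sub_right] at h5
  rw [inner_sub_left, inner_sub_left] at h5
  rw [inner_sub_left]
  linarith

/-- It makes the hull in `clarke_envelope` closed, hence testable by support functions. Closedness
comes from upper semicontinuity jointly in the point and `θ`. -/
theorem isCompact_iUnion_clarke_inner {q : E → H} {w : E} (hq : LipschitzNear q w) {Θ : Set H}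
    (hΘ : IsCompact Θ) : IsCompact (⋃ θ ∈ Θ, clarke (fun x => inner ℝ (q x) θ) w) := by
  obtain ⟨R, hR⟩ := hΘ.isBounded.exists_norm_le
  obtain ⟨K, s, hs, hK⟩ := id hq
  refine (isCompact_closedBall (0 : E) (K * R)).of_isClosed_subset ?_ ?_
  · refine IsSeqClosed.isClosed fun c g hc hlim => ?_
    simp only [Set.mem_iUnion, exists_prop] at hc ⊢
    choose θ hθ hcθ using hc
    obtain ⟨θ₀, hθ₀, φ, hφ, hθlim⟩ := hΘ.tendsto_subseq hθ
    refine ⟨θ₀, hθ₀, mem_of_forall_inner_le (convex_convexHull ℝ _)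
      (isCompact_clarke (hq.inner_const θ₀)).isClosed fun h S hS => ?_⟩
    refine le_of_forall_pos_le_add fun ε hε => ?_
    refine le_of_tendsto ((hlim.comp hφ.tendsto_atTop).inner tendsto_const_nhds) ?_
    have hev := eventually_inner_sub_le_of_clarke hq hS hε
    rw [nhds_prod_eq, eventually_swap_iff] at hev
    filter_upwards [hθlim.eventually hev.curry] with k hk
    refine inner_le_of_mem_clarke (hcθ (φ k)) fun ε' hε' => ?_
    filter_upwards [hk] with p hp t ht hpt
    have := hp t ht hpt
    dsimp only [Function.comp_apply, Prod.swap] at this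
    rw [inner_sub_left] at this
    exact this.trans (mul_le_mul_of_nonneg_left (by linarith) ht)
  · intro g hg
    simp only [Set.mem_iUnion, exists_prop] at hg
    obtain ⟨θ, hθ, hgθ⟩ := hg
    have h1 := norm_le_of_mem_clarke hs (hK.inner_const θ) hgθ
    rw [mem_closedBall_zero_iff]
    refine h1.trans ?_
    rw [NNReal.coe_mul]
    exact mul_le_mul_of_nonneg_left (hR θ hθ) K.2

/-- **Envelope theorem** for Clarke subdifferentials: if the increments of `Z` near `w` are
asymptotically bounded by those of functions `⟪q, θ⟫`, with `θ` in a compact set, then the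
generalized gradients of `Z` are convex combinations of those of the functions `⟪q, θ⟫`. -/
theorem clarke_envelope {q : E → H} {Z : E → ℝ} {w : E} {Θ : Set H} (hq : LipschitzNear q w)
    (hΘ : IsCompact Θ)
    (hZ : ∀ ε > 0, ∀ᶠ p : E × E in 𝓝 (w, w), ∃ θ ∈ Θ,
      Z p.2 - Z p.1 ≤ inner ℝ (q p.2 - q p.1) θ + ε * ‖q p.2 - q p.1‖) :
    LipschitzNear Z w ∧ (clarke Z w).Nonempty ∧
      clarke Z w ⊆ convexHull ℝ (⋃ θ ∈ Θ, clarke (fun x => inner ℝ (q x) θ) w) := by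
  have hlip : LipschitzNear Z w := by
    obtain ⟨R, hR0, hR⟩ := hΘ.isBounded.exists_pos_norm_le
    obtain ⟨K, s, hs, hK⟩ := id hq
    have hev := hZ 1 one_pos
    rw [nhds_prod_eq] at hev
    obtain ⟨t, ht, htZ⟩ := eventually_prod_self_iff'.1 hev
    have key : ∀ x ∈ s ∩ t, ∀ y ∈ s ∩ t, Z y - Z x ≤ K * (R + 1) * dist x y := by
      intro x hx y hy
      obtain ⟨θ, hθ, hle⟩ := htZ x hx.2 y hy.2
      have h1 : ‖q y - q x‖ ≤ K * dist x y := by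
        rw [← dist_eq_norm, dist_comm x y]
        exact hK.dist_le_mul y hy.1 x hx.1
      have h2 : inner ℝ (q y - q x) θ ≤ ‖q y - q x‖ * R :=
        (real_inner_le_norm _ _).trans (mul_le_mul_of_nonneg_left (hR θ hθ) (norm_nonneg _))
      dsimp only at hle
      nlinarith
    refine ⟨K * (R + 1).toNNReal, s ∩ t, inter_mem hs ht,
      LipschitzOnWith.of_dist_le_mul fun x hx y hy => ?_⟩
    rw [Real.dist_eq, abs_le]
    have h1 := key x hx y hy
    have h2 := key y hy x hx
    rw [dist_comm y x] at h2
    rw [NNReal.coe_mul, Real.coe_toNNReal _ (by positivity)]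
    constructor <;> linarith
  refine ⟨hlip, clarke_nonempty hlip, fun g hg => ?_⟩
  refine mem_of_forall_inner_le (convex_convexHull ℝ _)
    (isCompact_iUnion_clarke_inner hq hΘ).convexHull_of_finiteDimensional.isClosed
    fun h S hS => inner_le_of_mem_clarke hg fun ε hε => ?_
  -- The `θ` supplied by `hZ` depends on the two points; compactness of `Θ` provides one
  -- neighbourhood good for all `θ`.
  have hev : ∀ᶠ p : E × E in 𝓝 (w, w), ∀ θ ∈ Θ, ∀ t : ℝ, 0 ≤ t → p.2 - p.1 = t • h →
      inner ℝ (q p.2 - q p.1) θ ≤ t * (S + ε / 2) := by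
    refine hΘ.eventually_forall_of_forall_eventually fun θ hθ => ?_
    refine eventually_inner_sub_le_of_clarke hq (fun g hg => hS g ?_) (half_pos hε)
    exact subset_convexHull ℝ _ (Set.mem_biUnion hθ hg)
  obtain ⟨K, s, hs, hK⟩ := id hq
  have hc : 0 < ε / 2 / (K * ‖h‖ + 1) := by positivity
  filter_upwards [hev, hZ _ hc, prod_mem_nhds hs hs] with p h1 h2 h3 t ht hpt
  obtain ⟨θ, hθ, hle⟩ := h2
  have h4 := h1 θ hθ t ht hpt
  have hd := hK.dist_le_mul _ h3.2 _ h3.1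
  rw [dist_eq_norm, dist_eq_norm, hpt, norm_smul, Real.norm_of_nonneg ht] at hd
  have h5 : ε / 2 / (K * ‖h‖ + 1) * ‖q p.2 - q p.1‖ ≤ t * (ε / 2) := by
    calc ε / 2 / (K * ‖h‖ + 1) * ‖q p.2 - q p.1‖
        ≤ ε / 2 / (K * ‖h‖ + 1) * (K * (t * ‖h‖)) := by gcongr
      _ = t * (ε / 2) * ((K * ‖h‖) / (K * ‖h‖ + 1)) := by field_simp
      _ ≤ t * (ε / 2) * 1 := by
        gcongr
        rw [div_le_one (by positivity)]
        linarith
      _ = t * (ε / 2) := mul_one _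
  linarith

end ClarkeCalculus

/-! ### Farkas' lemma and linear programming duality. -/

section LinearPrograms

open Filter Metric

/-- **Farkas' lemma**: a linear functional that is nonnegative wherever finitely many linear
functionals are nonnegative is a nonnegative combination of them. -/
theorem exists_nonneg_combination_fin {V : Type*} [AddCommGroup V] [Module ℝ V] {k : ℕ}
    (a : Fin k → V →ₗ[ℝ] ℝ) (b : V →ₗ[ℝ] ℝ) (h : ∀ x, (∀ i, 0 ≤ a i x) → 0 ≤ b x) :
    ∃ l : Fin k → ℝ, (∀ i, 0 ≤ l i) ∧ ∀ x, b x = ∑ i, l i * a i x := by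
  induction k generalizing b with
  | zero =>
    refine ⟨0, fun i => i.elim0, fun x => ?_⟩
    have h1 := h x fun i => i.elim0
    have h2 := h (-x) fun i => i.elim0
    rw [map_neg] at h2
    simpa using le_antisymm (by linarith) h1
  | succ k ih =>
    by_cases hlast : ∀ x, (∀ i : Fin k, 0 ≤ a i.castSucc x) → 0 ≤ b x
    · obtain ⟨l, hl, hb⟩ := ih _ b hlast
      refine ⟨Fin.snoc l 0, fun i => ?_, fun x => ?_⟩
      · refine Fin.lastCases ?_ (fun j => ?_) i <;> simp [hl]
      · simp [Fin.sum_univ_castSucc, hb x]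
    push Not at hlast
    obtain ⟨z, hz, hbz⟩ := hlast
    have haz : a (Fin.last k) z < 0 := by
      by_contra hcon
      exact absurd (h z fun i => Fin.lastCases (not_lt.1 hcon) hz i) (not_le.2 hbz)
    -- The modified functionals are the old ones composed with the projection along `z` onto the
    -- kernel of the last one, so the hypothesis applies to the projected point.
    obtain ⟨l, hl, hb⟩ := ih
      (fun i => a i.castSucc - (a i.castSucc z / a (Fin.last k) z) • a (Fin.last k))
      (b - (b z / a (Fin.last k) z) • a (Fin.last k)) fun x hx => by
        have := h (x - (a (Fin.last k) x / a (Fin.last k) z) • z) fun i => by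
          refine Fin.lastCases ?_ (fun j => ?_) i
          · simp [haz.ne]
          · refine (hx j).trans_eq ?_
            simp only [LinearMap.sub_apply, LinearMap.smul_apply, smul_eq_mul, map_sub, map_smul]
            ring
        refine this.trans_eq ?_
        simp only [LinearMap.sub_apply, LinearMap.smul_apply, smul_eq_mul, map_sub, map_smul]
        ring
    refine ⟨Fin.snoc l (b z / a (Fin.last k) z
      - ∑ i, l i * (a i.castSucc z / a (Fin.last k) z)), fun i => ?_, fun x => ?_⟩
    · refine Fin.lastCases ?_ (fun j => ?_) i
      · simp only [Fin.snoc_last, sub_nonneg]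
        refine (Finset.sum_nonpos fun i _ => ?_).trans (div_nonneg_of_nonpos hbz.le haz.le)
        exact mul_nonpos_of_nonneg_of_nonpos (hl i) (div_nonpos_of_nonneg_of_nonpos (hz i) haz.le)
      · simpa using hl j
    · have := hb x
      simp only [LinearMap.sub_apply, LinearMap.smul_apply, smul_eq_mul, mul_sub,
        Finset.sum_sub_distrib] at this
      simp only [Fin.sum_univ_castSucc, Fin.snoc_castSucc, Fin.snoc_last, sub_mul,
        Finset.sum_mul]
      simp only [mul_assoc]
      linarith

theorem exists_nonneg_combination {V ι : Type*} [AddCommGroup V] [Module ℝ V] [Fintype ι]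
    (a : ι → V →ₗ[ℝ] ℝ) (b : V →ₗ[ℝ] ℝ) (h : ∀ x, (∀ i, 0 ≤ a i x) → 0 ≤ b x) :
    ∃ l : ι → ℝ, (∀ i, 0 ≤ l i) ∧ ∀ x, b x = ∑ i, l i * a i x := by
  let e := Fintype.equivFin ι
  obtain ⟨l, hl, hb⟩ := exists_nonneg_combination_fin (fun i => a (e.symm i)) b fun x hx =>
    h x fun i => by simpa using hx (e i)
  refine ⟨l ∘ e, fun i => hl _, fun x => ?_⟩
  rw [hb x, ← e.sum_comp]
  simp

variable {m n : ℕ} {I : Set (Fin m)} {c : Vec n} {A : Mat m n} {b : Vec m} {u : Vec n} {v : Vec m}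

theorem inner_vec {k : ℕ} (x y : Vec k) : inner ℝ x y = ∑ i, x i * y i := by
  simp [PiLp.inner_apply, mul_comm]

/-- The bilinear form `vᵀ A u`. -/
noncomputable def bilin (A : Mat m n) (v : Vec m) (u : Vec n) : ℝ :=
  ∑ i, ∑ j, v i * A (i, j) * u j

theorem bilin_eq_left (A : Mat m n) (v : Vec m) (u : Vec n) :
    bilin A v u = ∑ i, v i * ∑ j, A (i, j) * u j := by
  simp only [bilin, Finset.mul_sum, mul_assoc]

theorem bilin_eq_right (A : Mat m n) (v : Vec m) (u : Vec n) :
    bilin A v u = ∑ j, (∑ i, A (i, j) * v i) * u j := by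
  simp only [bilin, Finset.sum_mul]
  rw [Finset.sum_comm]
  exact Finset.sum_congr rfl fun j _ => Finset.sum_congr rfl fun i _ => by ring

theorem inner_negOuter (A : Mat m n) (v : Vec m) (u : Vec n) :
    inner ℝ A (negOuter v u) = -bilin A v u := by
  simp only [PiLp.inner_apply, negOuter, bilin, Fintype.sum_prod_type, ← Finset.sum_neg_distrib]
  exact Finset.sum_congr rfl fun i _ => Finset.sum_congr rfl fun j _ => by simp; ring

/-- This and `bilin_le_inner` are the halves of weak duality. They are kept apart because later `u`
and `v` solve different programs. -/
theorem inner_le_bilin {I : Set (Fin m)} (hu : u ∈ lpFeasible I A b) (hv : ∀ i ∈ I, 0 ≤ v i) :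
    inner ℝ b v ≤ bilin A v u := by
  rw [inner_vec, bilin_eq_left]
  refine Finset.sum_le_sum fun i _ => ?_
  rw [mul_comm]
  by_cases hi : i ∈ I
  · exact mul_le_mul_of_nonneg_left (hu.2.1 i hi) (hv i hi)
  · rw [hu.2.2 i hi]

theorem bilin_le_inner {I : Set (Fin m)} (hv : v ∈ dualFeasible I A c) (hu : ∀ j, 0 ≤ u j) :
    bilin A v u ≤ inner ℝ c u := by
  rw [inner_vec, bilin_eq_right]
  exact Finset.sum_le_sum fun j _ => mul_le_mul_of_nonneg_right (hv.2 j) (hu j)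

theorem weak_duality (hu : u ∈ lpFeasible I A b) (hv : v ∈ dualFeasible I A c) :
    inner ℝ b v ≤ inner ℝ c u :=
  (inner_le_bilin hu hv.1).trans (bilin_le_inner hv hu.1)

theorem add_mem_lpFeasible {b' : Vec m} {u' : Vec n} (hu : u ∈ lpFeasible I A b)
    (hu' : u' ∈ lpFeasible I A b') : u + u' ∈ lpFeasible I A (b + b') := by
  refine ⟨fun j => add_nonneg (hu.1 j) (hu'.1 j), fun i hi => ?_, fun i hi => ?_⟩
  · simp only [PiLp.add_apply, mul_add, Finset.sum_add_distrib]
    exact add_le_add (hu.2.1 i hi) (hu'.2.1 i hi)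
  · simp only [PiLp.add_apply, mul_add, Finset.sum_add_distrib]
    rw [hu.2.2 i hi, hu'.2.2 i hi]

theorem smul_mem_lpFeasible (hu : u ∈ lpFeasible I A b) {s : ℝ} (hs : 0 ≤ s) :
    s • u ∈ lpFeasible I A (s • b) := by
  have hsum : ∀ i, ∑ j, A (i, j) * (s • u) j = s * ∑ j, A (i, j) * u j := fun i => by
    rw [Finset.mul_sum]
    exact Finset.sum_congr rfl fun j _ => by simp; ring
  refine ⟨fun j => mul_nonneg hs (hu.1 j), fun i hi => ?_, fun i hi => ?_⟩
  · rw [hsum]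
    exact mul_le_mul_of_nonneg_left (hu.2.1 i hi) hs
  · rw [hsum, hu.2.2 i hi]
    rfl

theorem smul_mem_dualFeasible (hv : v ∈ dualFeasible I A c) {s : ℝ} (hs : 0 ≤ s) :
    s • v ∈ dualFeasible I A (s • c) := by
  refine ⟨fun i hi => mul_nonneg hs (hv.1 i hi), fun j => ?_⟩
  have : ∑ i, A (i, j) * (s • v) i = s * ∑ i, A (i, j) * v i := by
    rw [Finset.mul_sum]
    exact Finset.sum_congr rfl fun i _ => by simp; ring
  rw [this]
  exact mul_le_mul_of_nonneg_left (hv.2 j) hs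

/-- The cost does not decrease along recession directions. -/
theorem LPFinite.inner_nonneg (h : LPFinite I c A b) (hu : u ∈ lpFeasible I A 0) :
    0 ≤ inner ℝ c u := by
  obtain ⟨⟨u₀, hu₀⟩, M, hM⟩ := h
  by_contra! hneg
  have hmem : ∀ s : ℝ, 0 ≤ s → M ≤ inner ℝ c u₀ + s * inner ℝ c u := by
    intro s hs
    have h1 := add_mem_lpFeasible hu₀ (smul_mem_lpFeasible hu hs)
    rw [smul_zero, add_zero] at h1
    have := hM ⟨_, h1, rfl⟩
    dsimp only at this
    rwa [inner_add_right, real_inner_smul_right] at this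
  have h0 := hmem 0 le_rfl
  have h1 := hmem ((inner ℝ c u₀ - M + 1) / -inner ℝ c u)
    (div_nonneg (by linarith) (by linarith))
  rw [div_mul_eq_mul_div, mul_div_assoc, div_neg, div_self hneg.ne] at h1
  linarith

theorem IsOptimalValue.lpFinite {z : ℝ} (h : IsOptimalValue (lpFeasible I A b) c z) :
    LPFinite I c A b :=
  ⟨h.nonempty.of_image, h.bddBelow⟩

/-- Pairs of feasible solutions of the primal and the dual program with equal objective values. -/
def saddleSet (I : Set (Fin m)) (c : Vec n) (A : Mat m n) (b : Vec m) : Set (Vec n × Vec m) :=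
  {p | p.1 ∈ lpFeasible I A b ∧ p.2 ∈ dualFeasible I A c ∧ inner ℝ c p.1 ≤ inner ℝ b p.2}

open Classical in
/-- **Strong duality** of linear programming. -/
theorem LPFinite.saddleSet_nonempty (h : LPFinite I c A b) : (saddleSet I c A b).Nonempty := by
  -- `e` is a switch: on equality rows it adds the reverse inequality, on the others the sign
  -- condition on `v`.
  let e : Fin m → ℝ := fun i => if i ∈ I then 0 else 1
  let pu : Fin n → (Vec n × Vec m × ℝ) →ₗ[ℝ] ℝ := fun j =>
    (EuclideanSpace.proj j : Vec n →L[ℝ] ℝ).toLinearMap ∘ₗ LinearMap.fst ℝ _ _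
  let pv : Fin m → (Vec n × Vec m × ℝ) →ₗ[ℝ] ℝ := fun i =>
    (EuclideanSpace.proj i : Vec m →L[ℝ] ℝ).toLinearMap ∘ₗ LinearMap.fst ℝ _ _ ∘ₗ
      LinearMap.snd ℝ _ _
  let pt : (Vec n × Vec m × ℝ) →ₗ[ℝ] ℝ := LinearMap.snd ℝ _ _ ∘ₗ LinearMap.snd ℝ _ _
  let Au : Fin m → (Vec n × Vec m × ℝ) →ₗ[ℝ] ℝ := fun i => ∑ j, A (i, j) • pu j
  let Av : Fin n → (Vec n × Vec m × ℝ) →ₗ[ℝ] ℝ := fun j => ∑ i, A (i, j) • pv i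
  let f : (Fin n ⊕ Fin n) ⊕ (Fin m ⊕ Fin m ⊕ Fin m) ⊕ Unit → (Vec n × Vec m × ℝ) →ₗ[ℝ] ℝ :=
    Sum.elim (Sum.elim pu fun j => c j • pt - Av j)
      (Sum.elim (Sum.elim (fun i => Au i - b i • pt)
        (Sum.elim (fun i => e i • (b i • pt - Au i)) fun i => (1 - e i) • pv i))
        fun _ => ∑ i, b i • pv i - ∑ j, c j • pu j)
  have hAu : ∀ i x, Au i x = ∑ j, A (i, j) * x.1 j := fun i x => by simp [Au, pu]
  have hAv : ∀ j x, Av j x = ∑ i, A (i, j) * x.2.1 i := fun i x => by simp [Av, pv]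
  have hpu : ∀ j x, pu j x = x.1 j := fun _ _ => rfl
  have hpv : ∀ j x, pv j x = x.2.1 j := fun _ _ => rfl
  have hpt : ∀ x, pt x = x.2.2 := fun _ => rfl
  -- The optimality system is homogenized by `t`. A solution with `t > 0` can be divided by `t`;
  -- otherwise Farkas' lemma writes `-t` as a nonnegative combination of the constraints.
  by_cases hf : ∀ x, (∀ r, 0 ≤ f r x) → 0 ≤ (-pt) x
  · exfalso
    obtain ⟨l, hl, hlx⟩ := exists_nonneg_combination f (-pt) hf
    obtain ⟨lu, hlu⟩ : ∃ lu : Fin n → ℝ, lu = fun j => l (.inl (.inl j)) := ⟨_, rfl⟩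
    obtain ⟨ν, hν⟩ : ∃ ν : Vec n, ν = WithLp.toLp 2 fun j => l (.inl (.inr j)) := ⟨_, rfl⟩
    obtain ⟨y, hy⟩ : ∃ y : Vec m, y = WithLp.toLp 2 fun i => l (.inr (.inl (.inl i)))
      - e i * l (.inr (.inl (.inr (.inl i)))) := ⟨_, rfl⟩
    obtain ⟨lv, hlv⟩ : ∃ lv : Fin m → ℝ, lv = fun i => l (.inr (.inl (.inr (.inr i)))) :=
      ⟨_, rfl⟩
    obtain ⟨κ, hκ⟩ : ∃ κ, κ = l (.inr (.inr ())) := ⟨_, rfl⟩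
    have key : ∀ (u : Vec n) (v : Vec m) (t : ℝ), -t = ∑ j, lu j * u j
        + ∑ j, ν j * (c j * t - ∑ i, A (i, j) * v i)
        + ∑ i, y i * (∑ j, A (i, j) * u j - b i * t)
        + ∑ i, lv i * (1 - e i) * v i + κ * (∑ i, b i * v i - ∑ j, c j * u j) := by
      intro u v t
      have h1 := hlx (u, v, t)
      simp only [Fintype.sum_sum_type, f, Sum.elim_inl, Sum.elim_inr, LinearMap.sub_apply,
        LinearMap.smul_apply, LinearMap.neg_apply, hAu, hAv, hpu, hpv, hpt, smul_eq_mul,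
        LinearMap.sum_apply, Finset.univ_unique, Finset.sum_singleton] at h1
      rw [h1, hlu, hν, hy, hlv, hκ]
      have h2 : ∀ i, (l (.inr (.inl (.inl i))) - e i * l (.inr (.inl (.inr (.inl i)))))
          * (∑ j, A (i, j) * u j - b i * t)
          = l (.inr (.inl (.inl i))) * (∑ j, A (i, j) * u j - b i * t)
          + l (.inr (.inl (.inr (.inl i)))) * (e i * (b i * t - ∑ j, A (i, j) * u j)) :=
        fun i => by ring
      simp only [h2, Finset.sum_add_distrib, mul_assoc, PUnit.default_eq_unit]
      ring
    have hν0 : ∀ j, 0 ≤ ν j := fun j => by rw [hν]; exact hl _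
    have hκ0 : 0 ≤ κ := hκ ▸ hl _
    have hlv0 : ∀ i, 0 ≤ lv i := fun i => by rw [hlv]; exact hl _
    have hlu0 : ∀ i, 0 ≤ lu i := fun i => by rw [hlu]; exact hl _
    have hobj : inner ℝ b y = inner ℝ c ν + 1 := by
      have h1 := key 0 0 1
      simp only [PiLp.zero_apply, mul_zero, Finset.sum_const_zero, mul_one, sub_zero, zero_sub,
        zero_add, add_zero, mul_neg, Finset.sum_neg_distrib] at h1
      rw [inner_vec, inner_vec]
      simp only [mul_comm (b _), mul_comm (c _)]
      linarith
    have hydual : y ∈ dualFeasible I A (κ • c) := by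
      refine ⟨fun i hi => ?_, fun j => ?_⟩
      · rw [hy]
        simp only [e, if_pos hi, zero_mul, sub_zero]
        exact hl _
      · have h1 := key (EuclideanSpace.single j 1) 0 0
        simp [mul_comm (y _)] at h1
        simp
        linarith [hlu0 j]
    have hνprimal : ν ∈ lpFeasible I A (κ • b) := by
      have hcol : ∀ i, 0 = -∑ j, A (i, j) * ν j + lv i * (1 - e i) + κ * b i := by
        intro i
        have h1 := key 0 (EuclideanSpace.single i 1) 0
        simpa [mul_comm (ν _)] using h1
      refine ⟨hν0, fun i hi => ?_, fun i hi => ?_⟩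
      · have h1 := hcol i
        simp only [e, if_pos hi] at h1
        simp
        linarith [hlv0 i]
      · have h1 := hcol i
        simp only [e, if_neg hi] at h1
        simp
        linarith
    -- With `hobj` this forces `κ = 0`. Then `ν` is a recession direction, of cost at least `0`,
    -- while `⟪b, y⟫ ≤ 0`, against `hobj`.
    have hw := weak_duality hνprimal hydual
    rw [real_inner_smul_left, real_inner_smul_left, hobj] at hw
    have hκz : κ = 0 := le_antisymm (by linarith) hκ0
    rw [hκz, zero_smul] at hνprimal hydual
    obtain ⟨u₀, hu₀⟩ := h.1
    have h1 := weak_duality hu₀ hydual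
    have h2 := h.inner_nonneg hνprimal
    rw [inner_zero_left] at h1
    linarith
  · push Not at hf
    obtain ⟨⟨u, v, t⟩, hx, ht⟩ := hf
    have ht : 0 < t := by simpa [hpt] using ht
    have h1 : ∀ j, 0 ≤ u j := fun j => hx (.inl (.inl j))
    have h2 : ∀ j, ∑ i, A (i, j) * v i ≤ c j * t := fun j => by
      have := hx (.inl (.inr j))
      simpa [f, hAv, hpt] using this
    have h3 : ∀ i, b i * t ≤ ∑ j, A (i, j) * u j := fun i => by
      have := hx (.inr (.inl (.inl i)))
      simpa [f, hAu, hpt] using this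
    have h4 : ∀ i ∉ I, ∑ j, A (i, j) * u j ≤ b i * t := fun i hi => by
      have := hx (.inr (.inl (.inr (.inl i))))
      simpa [f, hAu, hpt, e, hi] using this
    have h5 : ∀ i ∈ I, 0 ≤ v i := fun i hi => by
      have := hx (.inr (.inl (.inr (.inr i))))
      simpa [f, hpv, e, hi] using this
    have h6 : ∑ j, c j * u j ≤ ∑ i, b i * v i := by
      have := hx (.inr (.inr ()))
      simpa [f, hpv, hpu] using this
    have hu : u ∈ lpFeasible I A (t • b) :=
      ⟨h1, fun i _ => by simpa [mul_comm] using h3 i,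
        fun i hi => by simpa [mul_comm] using le_antisymm (h4 i hi) (h3 i)⟩
    have hv : v ∈ dualFeasible I A (t • c) := ⟨h5, fun j => by simpa [mul_comm] using h2 j⟩
    have hti : (0 : ℝ) ≤ t⁻¹ := inv_nonneg.2 ht.le
    refine ⟨(t⁻¹ • u, t⁻¹ • v), ?_, ?_, ?_⟩
    · simpa [smul_smul, inv_mul_cancel₀ ht.ne'] using smul_mem_lpFeasible hu hti
    · simpa [smul_smul, inv_mul_cancel₀ ht.ne'] using smul_mem_dualFeasible hv hti
    · rw [real_inner_smul_right, real_inner_smul_right, inner_vec, inner_vec]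
      exact mul_le_mul_of_nonneg_left h6 hti

end LinearPrograms

/-! ### Finite selections of minimizers over polyhedra. -/

section Polyhedra

open Filter Metric

/-- A set described by finitely many linear inequalities. -/
def IsPolyhedron {E : Type*} [AddCommGroup E] [Module ℝ E] (S : Set E) : Prop :=
  ∃ (ι : Type) (_ : Finite ι) (l : ι → E →ₗ[ℝ] ℝ) (β : ι → ℝ), S = {x | ∀ r, β r ≤ l r x}

/-- The points of `S` where a linear functional is minimal. -/
def minimizers {H : Type*} [NormedAddCommGroup H] [InnerProductSpace ℝ H] (S : Set H) (c : H) :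
    Set H :=
  {x | x ∈ S ∧ ∀ y ∈ S, inner ℝ c x ≤ inner ℝ c y}

theorem IsPolyhedron.convex {E : Type*} [AddCommGroup E] [Module ℝ E] {S : Set E}
    (hS : IsPolyhedron S) : Convex ℝ S := by
  obtain ⟨ι, _, l, β, rfl⟩ := hS
  rw [Set.ofPred_forall]
  exact convex_iInter fun r => convex_halfSpace_ge (l r).isLinear (β r)

theorem convex_minimizers {H : Type*} [NormedAddCommGroup H] [InnerProductSpace ℝ H] {S : Set H}
    (hS : Convex ℝ S) (c : H) : Convex ℝ (minimizers S c) := by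
  intro x hx y hy s t hs ht hst
  refine ⟨hS hx.1 hy.1 hs ht hst, fun z hz => ?_⟩
  rw [inner_add_right, real_inner_smul_right, real_inner_smul_right]
  have h1 := mul_le_mul_of_nonneg_left (hx.2 z hz) hs
  have h2 := mul_le_mul_of_nonneg_left (hy.2 z hz) ht
  have h3 : inner ℝ c z = s * inner ℝ c z + t * inner ℝ c z := by rw [← add_mul, hst, one_mul]
  linarith

/-- A polyhedron contains a finite set that meets the minimizers of every linear functional having
minimizers: it suffices to choose one point for each set of active constraints. -/
theorem IsPolyhedron.exists_finite_selection {H : Type*} [NormedAddCommGroup H]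
    [InnerProductSpace ℝ H] {S : Set H} (hS : IsPolyhedron S) :
    ∃ B ⊆ S, B.Finite ∧ ∀ c, (minimizers S c).Nonempty → (B ∩ minimizers S c).Nonempty := by
  obtain ⟨ι, _, l, β, rfl⟩ := hS
  set S := {x | ∀ r, β r ≤ l r x}
  let active : H → Set ι := fun x => {r | l r x = β r}
  obtain ⟨B, hBS, hB⟩ := S.exists_subset_bijOn active
  refine ⟨B, hBS, Set.Finite.of_finite_image (Set.toFinite _) hB.injOn, ?_⟩
  rintro c ⟨x, hx, hmin⟩
  obtain ⟨y, hyB, hyx⟩ := hB.surjOn ⟨x, hx, rfl⟩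
  refine ⟨y, hyB, hBS hyB, fun z hz => le_trans ?_ (hmin z hz)⟩
  -- As `x` and `y` have the same active constraints, one can move slightly from `x` away from `y`
  -- within `S`; minimality of `x` then bounds the cost of `y`.
  have hev : ∀ᶠ s : ℝ in 𝓝[>] 0, ∀ r, β r ≤ l r (x + s • (x - y)) := by
    refine eventually_all.2 fun r => ?_
    by_cases hr : l r x = β r
    · have hr' : l r y = β r := by
        have : r ∈ active x := hr
        rwa [← hyx] at this
      exact Eventually.of_forall fun s => by simp [hr, hr']
    · have hpos : β r < l r x := lt_of_le_of_ne (hx r) (Ne.symm hr)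
      have hc : Continuous fun s : ℝ => l r x + s * (l r x - l r y) := by fun_prop
      have ht := (hc.tendsto 0).mono_left (nhdsWithin_le_nhds (s := Set.Ioi 0))
      simp only [zero_mul, add_zero] at ht
      filter_upwards [ht.eventually (lt_mem_nhds hpos)] with s hs
      simpa using hs.le
  obtain ⟨s, hs, hs0⟩ := (hev.and self_mem_nhdsWithin).exists
  have hs0 : (0 : ℝ) < s := hs0
  have h1 := hmin _ hs
  rw [inner_add_right, real_inner_smul_right, inner_sub_right] at h1
  by_contra! hlt
  nlinarith

/-- Near `w`, the selected minimizers for `q x` are minimizers for `q w`. -/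
theorem eventually_exists_minimizer {X H : Type*} [TopologicalSpace X] [NormedAddCommGroup H]
    [InnerProductSpace ℝ H] {S B : Set H} (hBS : B ⊆ S) (hB : B.Finite)
    (hsel : ∀ c, (minimizers S c).Nonempty → (B ∩ minimizers S c).Nonempty) {q : X → H} {w : X}
    (hq : ContinuousAt q w) (hne : ∀ᶠ x in 𝓝 w, (minimizers S (q x)).Nonempty) :
    ∀ᶠ x in 𝓝 w, ∃ θ ∈ B ∩ minimizers S (q w), θ ∈ minimizers S (q x) := by
  -- Not being a minimizer is witnessed by a strict inequality, which persists near `w`; `B` is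
  -- finite.
  have hev : ∀ᶠ x in 𝓝 w, ∀ θ ∈ B, θ ∉ minimizers S (q w) → θ ∉ minimizers S (q x) := by
    refine (eventually_all_finite hB).2 fun θ hθ => ?_
    by_cases hθw : θ ∈ minimizers S (q w)
    · exact Eventually.of_forall fun x h => absurd hθw h
    · have : ∃ y ∈ S, inner ℝ (q w) y < inner ℝ (q w) θ := by
        by_contra! hcon
        exact hθw ⟨hBS hθ, hcon⟩
      obtain ⟨y, hy, hlt⟩ := this
      have h1 : ContinuousAt (fun x => inner ℝ (q x) y) w := hq.inner continuousAt_const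
      have h2 : ContinuousAt (fun x => inner ℝ (q x) θ) w := hq.inner continuousAt_const
      filter_upwards [h1.eventually_lt h2 hlt] with x hx _ hmem
      exact absurd (hmem.2 y hy) (not_le.2 hx)
  filter_upwards [hev, hne] with x h1 h2
  obtain ⟨θ, hθB, hθ⟩ := hsel _ h2
  exact ⟨θ, ⟨hθB, by_contra fun h => h1 θ hθB h hθ⟩, hθ⟩

theorem LipschitzNear.continuousAt {X Y : Type*} [PseudoMetricSpace X] [PseudoMetricSpace Y]
    {q : X → Y} {w : X} (hq : LipschitzNear q w) : ContinuousAt q w :=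
  let ⟨_, _, hs, hK⟩ := hq
  hK.continuousOn.continuousAt hs

variable {E H : Type*} [NormedAddCommGroup E] [InnerProductSpace ℝ E] [CompleteSpace E]
  [NormedAddCommGroup H] [InnerProductSpace ℝ H] [CompleteSpace H]

theorem hasStrictFDerivAt_inner_const {q : E → H} {q' : E →L[ℝ] H} {w : E}
    (hq : HasStrictFDerivAt q q' w) (θ : H) :
    HasStrictFDerivAt (fun x => inner ℝ (q x) θ)
      (InnerProductSpace.toDual ℝ E (ContinuousLinearMap.adjoint q' θ)) w := by
  have heq : InnerProductSpace.toDual ℝ E (ContinuousLinearMap.adjoint q' θ)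
      = ((innerSL ℝ).flip θ : H →L[ℝ] ℝ).comp q' := by
    ext h
    simp only [ContinuousLinearMap.comp_apply, InnerProductSpace.toDual_apply_apply,
      ContinuousLinearMap.adjoint_inner_left]
    exact real_inner_comm _ _
  rw [heq]
  exact ((innerSL ℝ).flip θ).hasStrictFDerivAt.comp w hq

/-- The subdifferential of an optimal value function near `w` that, up to sign, is the minimum of
the functions `⟪q, θ⟫` over a fixed feasible set, with optimizers `T` at `w`. -/
theorem clarke_of_selection [FiniteDimensional ℝ E] {q : E → H} {Z : E → ℝ} {w : E}
    {Θ T : Set H} (hq : LipschitzNear q w) (hΘ : Θ.Finite) (hΘT : Θ ⊆ T) (hT : Convex ℝ T)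
    (hw : ∀ θ ∈ T, Z w = inner ℝ (q w) θ) (hsel : ∀ᶠ x in 𝓝 w, ∃ θ ∈ Θ, Z x = inner ℝ (q x) θ)
    (hbd : (∀ᶠ x in 𝓝 w, ∀ θ ∈ T, Z x ≤ inner ℝ (q x) θ) ∨
      ∀ᶠ x in 𝓝 w, ∀ θ ∈ T, inner ℝ (q x) θ ≤ Z x) :
    LipschitzNear Z w ∧ (clarke Z w).Nonempty ∧
      clarke Z w ⊆ convexHull ℝ (⋃ θ ∈ T, clarke (fun x => inner ℝ (q x) θ) w) ∧
      ∀ q' : E →L[ℝ] H, HasStrictFDerivAt q q' w →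
        clarke Z w = (fun θ => ContinuousLinearMap.adjoint q' θ) '' T := by
  have henv : ∀ ε > 0, ∀ᶠ p : E × E in 𝓝 (w, w), ∃ θ ∈ Θ,
      Z p.2 - Z p.1 ≤ inner ℝ (q p.2 - q p.1) θ + ε * ‖q p.2 - q p.1‖ := by
    intro ε hε
    -- For a minimum take the optimizer at the starting point, for a maximum the one at the end
    -- point.
    rcases hbd with hbd | hbd
    · filter_upwards [prod_mem_nhds hsel hbd] with p hp
      obtain ⟨⟨θ, hθ, hZ⟩, h2⟩ := hp
      refine ⟨θ, hθ, ?_⟩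
      have h3 := h2 θ (hΘT hθ)
      rw [inner_sub_left, hZ]
      nlinarith [norm_nonneg (q p.2 - q p.1)]
    · filter_upwards [prod_mem_nhds hbd hsel] with p hp
      obtain ⟨h2, ⟨θ, hθ, hZ⟩⟩ := hp
      refine ⟨θ, hθ, ?_⟩
      have h3 := h2 θ (hΘT hθ)
      rw [inner_sub_left, hZ]
      nlinarith [norm_nonneg (q p.2 - q p.1)]
  obtain ⟨hlip, hne, hsub⟩ := clarke_envelope hq hΘ.isCompact henv
  have hsub' := hsub.trans (convexHull_mono (Set.biUnion_mono hΘT fun _ _ => subset_rfl))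
  refine ⟨hlip, hne, hsub', fun q' hq' => Set.Subset.antisymm ?_ ?_⟩
  · refine hsub'.trans (convexHull_min ?_
      (hT.linear_image (ContinuousLinearMap.adjoint q').toLinearMap))
    refine Set.iUnion₂_subset fun θ hθ g hg => ⟨θ, hθ, ?_⟩
    exact (clarke_subset_of_hasStrictFDerivAt (hasStrictFDerivAt_inner_const hq' θ) hg).symm
  · rintro _ ⟨θ, hθ, rfl⟩
    have hd := (hasStrictFDerivAt_inner_const hq' θ).hasFDerivAt
    rcases hbd with hbd | hbd
    · exact mem_clarke_of_le hlip hd (hbd.mono fun x hx => hx θ hθ) (hw θ hθ)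
    · exact mem_clarke_of_ge hlip hd (hbd.mono fun x hx => hx θ hθ) (hw θ hθ)

end Polyhedra

/-! ### Sensitivity to the cost vector and to the right-hand side. -/

section LinearPrograms

open Filter Metric

variable {m n : ℕ} {I : Set (Fin m)} {c : Vec n} {A : Mat m n} {b : Vec m}

theorem isPolyhedron_lpFeasible (I : Set (Fin m)) (A : Mat m n) (b : Vec m) :
    IsPolyhedron (lpFeasible I A b) := by
  let x : Fin n → Vec n →ₗ[ℝ] ℝ := fun j => (EuclideanSpace.proj j : Vec n →L[ℝ] ℝ).toLinearMap
  let row : Fin m → Vec n →ₗ[ℝ] ℝ := fun i => ∑ j, A (i, j) • x j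
  have hrow : ∀ i u, row i u = ∑ j, A (i, j) * u j := fun i u => by simp [row, x]
  refine ⟨Fin n ⊕ Fin m ⊕ {i // i ∉ I}, inferInstance,
    Sum.elim x (Sum.elim row fun i => -row i), Sum.elim 0 (Sum.elim b fun i => -b i), ?_⟩
  ext u
  simp only [lpFeasible, Set.mem_ofPred_eq, Sum.forall, Sum.elim_inl, Sum.elim_inr,
    LinearMap.neg_apply, hrow, neg_le_neg_iff, Subtype.forall]
  refine and_congr Iff.rfl ⟨fun h => ⟨fun i => ?_, fun i hi => (h.2 i hi).le⟩,
    fun h => ⟨fun i _ => h.1 i, fun i hi => le_antisymm (h.2 i hi) (h.1 i)⟩⟩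
  by_cases hi : i ∈ I
  · exact h.1 i hi
  · exact (h.2 i hi).ge

theorem isPolyhedron_dualFeasible (I : Set (Fin m)) (A : Mat m n) (c : Vec n) :
    IsPolyhedron (dualFeasible I A c) := by
  let y : Fin m → Vec m →ₗ[ℝ] ℝ := fun i => (EuclideanSpace.proj i : Vec m →L[ℝ] ℝ).toLinearMap
  let col : Fin n → Vec m →ₗ[ℝ] ℝ := fun j => ∑ i, A (i, j) • y i
  have hcol : ∀ j v, col j v = ∑ i, A (i, j) * v i := fun j v => by simp [col, y]
  refine ⟨{i // i ∈ I} ⊕ Fin n, inferInstance,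
    Sum.elim (fun i => y i) fun j => -col j, Sum.elim 0 fun j => -c j, ?_⟩
  ext v
  simp only [dualFeasible, Set.mem_ofPred_eq, Sum.forall, Sum.elim_inl, Sum.elim_inr,
    LinearMap.neg_apply, hcol, neg_le_neg_iff, Subtype.forall]
  rfl

theorem primalSolutions_eq_minimizers :
    primalSolutions I c A b = minimizers (lpFeasible I A b) c := rfl

theorem dualSolutions_eq_minimizers :
    dualSolutions I c A b = minimizers (dualFeasible I A c) (-b) := by
  ext v
  simp [dualSolutions, minimizers]

theorem isOptimalValue_of_mem_saddleSet {p : Vec n × Vec m} (hp : p ∈ saddleSet I c A b) :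
    IsOptimalValue (lpFeasible I A b) c (inner ℝ c p.1) := by
  refine ⟨⟨p.1, hp.1, rfl⟩, ?_⟩
  rintro _ ⟨u, hu, rfl⟩
  exact hp.2.2.trans (weak_duality hu hp.2.1)

theorem lpValue_eq_of_mem_saddleSet {p : Vec n × Vec m} (hp : p ∈ saddleSet I c A b) :
    lpValue I c A b = inner ℝ c p.1 :=
  (isOptimalValue_of_mem_saddleSet hp).csInf_eq

theorem inner_eq_of_mem_saddleSet {p : Vec n × Vec m} (hp : p ∈ saddleSet I c A b) :
    inner ℝ c p.1 = inner ℝ b p.2 :=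
  le_antisymm hp.2.2 (weak_duality hp.1 hp.2.1)

/-- The product form allows a primal solution from one pair to be combined with a dual solution from
another. -/
theorem LPFinite.saddleSet_eq (h : LPFinite I c A b) :
    saddleSet I c A b = primalSolutions I c A b ×ˢ dualSolutions I c A b := by
  obtain ⟨p, hp⟩ := h.saddleSet_nonempty
  ext ⟨u, v⟩
  constructor
  · rintro ⟨hu, hv, huv⟩
    exact ⟨⟨hu, fun u' hu' => huv.trans (weak_duality hu' hv)⟩,
      ⟨hv, fun v' hv' => (weak_duality hu hv').trans huv⟩⟩
  · rintro ⟨hu, hv⟩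
    exact ⟨hu.1, hv.1, (hu.2 _ hp.1).trans (hp.2.2.trans (hv.2 _ hp.2.1))⟩

/-- Sensitivity of the optimal value to the cost vector. -/
theorem clarke_of_cost {d : ℕ} {Z : Vec d → ℝ} {w : Vec d} {c : Vec d → Vec n}
    (hc : LipschitzNear c w)
    (hZ : ∀ᶠ x in 𝓝 w, IsOptimalValue (lpFeasible I A b) (c x) (Z x)) :
    LipschitzNear Z w ∧ (clarke Z w).Nonempty ∧
      clarke Z w ⊆ convexHull ℝ
        (⋃ u ∈ primalSolutions I (c w) A b, clarke (fun x => inner ℝ (c x) u) w) ∧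
      ∀ c' : Vec d →L[ℝ] Vec n, HasStrictFDerivAt c c' w → clarke Z w =
        (fun u => ContinuousLinearMap.adjoint c' u) '' primalSolutions I (c w) A b := by
  rw [primalSolutions_eq_minimizers]
  have hS := isPolyhedron_lpFeasible I A b
  have hval : ∀ {x}, IsOptimalValue (lpFeasible I A b) (c x) (Z x) →
      ∀ θ ∈ minimizers (lpFeasible I A b) (c x), Z x = inner ℝ (c x) θ := by
    rintro x ⟨⟨u, hu, hux⟩, hlow⟩ θ hθ
    exact le_antisymm (hlow ⟨θ, hθ.1, rfl⟩) (hux ▸ hθ.2 u hu)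
  obtain ⟨B, hBS, hB, hsel⟩ := hS.exists_finite_selection
  refine clarke_of_selection hc (hB.inter_of_left _) Set.inter_subset_right
    (convex_minimizers hS.convex _) (hval hZ.self_of_nhds) ?_ (.inl ?_)
  · have hne : ∀ᶠ x in 𝓝 w, (minimizers (lpFeasible I A b) (c x)).Nonempty := by
      filter_upwards [hZ] with x ⟨⟨u, hu, hux⟩, hlow⟩
      exact ⟨u, hu, fun y hy => hux.trans_le (hlow ⟨y, hy, rfl⟩)⟩
    filter_upwards [hZ, eventually_exists_minimizer hBS hB hsel hc.continuousAt hne]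
      with x h1 ⟨θ, hθ, hθx⟩
    exact ⟨θ, hθ, hval h1 θ hθx⟩
  · filter_upwards [hZ] with x hx θ hθ
    exact hx.2 ⟨θ, hθ.1, rfl⟩

/-- Sensitivity of the optimal value to the right-hand side. -/
theorem clarke_of_rhs {d : ℕ} {Z : Vec d → ℝ} {w : Vec d} {b : Vec d → Vec m}
    (hb : LipschitzNear b w)
    (hZ : ∀ᶠ x in 𝓝 w, IsOptimalValue (lpFeasible I A (b x)) c (Z x)) :
    LipschitzNear Z w ∧ (clarke Z w).Nonempty ∧
      clarke Z w ⊆ convexHull ℝ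
        (⋃ v ∈ dualSolutions I c A (b w), clarke (fun x => inner ℝ (b x) v) w) ∧
      ∀ b' : Vec d →L[ℝ] Vec m, HasStrictFDerivAt b b' w → clarke Z w =
        (fun v => ContinuousLinearMap.adjoint b' v) '' dualSolutions I c A (b w) := by
  have hS := isPolyhedron_dualFeasible I A c
  have hne : ∀ {x}, IsOptimalValue (lpFeasible I A (b x)) c (Z x) →
      ∃ v ∈ dualSolutions I c A (b x), Z x = inner ℝ (b x) v := by
    intro x hx
    obtain ⟨p, hp⟩ := hx.lpFinite.saddleSet_nonempty
    refine ⟨p.2, (hx.lpFinite.saddleSet_eq ▸ hp).2, ?_⟩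
    rw [← inner_eq_of_mem_saddleSet hp]
    exact hx.unique (isOptimalValue_of_mem_saddleSet hp)
  have hval : ∀ {x}, IsOptimalValue (lpFeasible I A (b x)) c (Z x) →
      ∀ θ ∈ dualSolutions I c A (b x), Z x = inner ℝ (b x) θ := by
    intro x hx θ hθ
    obtain ⟨v, hv, hvx⟩ := hne hx
    exact le_antisymm (hvx ▸ hθ.2 v hv.1) (hvx ▸ hv.2 θ hθ.1)
  obtain ⟨B, hBS, hB, hsel⟩ := hS.exists_finite_selection
  refine clarke_of_selection (Θ := B ∩ dualSolutions I c A (b w)) hb (hB.inter_of_left _)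
    Set.inter_subset_right ?_ (hval hZ.self_of_nhds) ?_ (.inr ?_)
  · rw [dualSolutions_eq_minimizers]
    exact convex_minimizers hS.convex _
  · have hne' : ∀ᶠ x in 𝓝 w, (minimizers (dualFeasible I A c) (-b x)).Nonempty := by
      filter_upwards [hZ] with x hx
      rw [← dualSolutions_eq_minimizers]
      obtain ⟨v, hv, -⟩ := hne hx
      exact ⟨v, hv⟩
    filter_upwards [hZ, eventually_exists_minimizer hBS hB hsel hb.continuousAt.neg hne']
      with x h1 ⟨θ, hθ, hθx⟩
    rw [Pi.neg_apply, ← dualSolutions_eq_minimizers] at hθ hθx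
    exact ⟨θ, hθ, hval h1 θ hθx⟩
  · filter_upwards [hZ] with x hx θ hθ
    obtain ⟨v, hv, hvx⟩ := hne hx
    rw [hvx]
    exact hv.2 θ hθ.1

end LinearPrograms

/-! ### Stable programs and sensitivity to all data. -/

section Stability

open Filter Metric

variable {m n : ℕ} {I : Set (Fin m)} {c : Vec n} {A : Mat m n} {b : Vec m}

theorem isClosed_setOf_mem_saddleSet (I : Set (Fin m)) :
    IsClosed {z : (Vec n × Mat m n × Vec m) × (Vec n × Vec m) |
      z.2 ∈ saddleSet I z.1.1 z.1.2.1 z.1.2.2} := by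
  change IsClosed {z : (Vec n × Mat m n × Vec m) × (Vec n × Vec m) |
    ((∀ j, 0 ≤ z.2.1 j) ∧ (∀ i ∈ I, z.1.2.2 i ≤ ∑ j, z.1.2.1 (i, j) * z.2.1 j) ∧
      ∀ i ∉ I, ∑ j, z.1.2.1 (i, j) * z.2.1 j = z.1.2.2 i) ∧
    ((∀ i ∈ I, 0 ≤ z.2.2 i) ∧ ∀ j, ∑ i, z.1.2.1 (i, j) * z.2.2 i ≤ z.1.1 j) ∧
    inner ℝ z.1.1 z.2.1 ≤ inner ℝ z.1.2.2 z.2.2}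
  simp only [Set.ofPred_and, Set.ofPred_forall]
  refine IsClosed.inter (.inter (isClosed_iInter fun j => ?_) (.inter
    (isClosed_iInter fun i => isClosed_iInter fun _ => ?_)
    (isClosed_iInter fun i => isClosed_iInter fun _ => ?_))) (.inter (.inter
    (isClosed_iInter fun i => isClosed_iInter fun _ => ?_) (isClosed_iInter fun j => ?_)) ?_)
  any_goals exact isClosed_le (by fun_prop) (by fun_prop)
  exact isClosed_eq (by fun_prop) (by fun_prop)

/-- In a stable program there are no nonzero recession directions of primal-dual solutions. -/
theorem LPStable.eq_zero (h : LPStable I c A b) {e : Vec n} {d : Vec m}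
    (he : e ∈ lpFeasible I A 0) (hd : d ∈ dualFeasible I A 0) (hed : inner ℝ c e ≤ inner ℝ b d) :
    e = 0 ∧ d = 0 := by
  -- For small `s > 0` the program with cost `c - s • e` and right-hand side `b + s • d` is still
  -- finite, so `⟪c, e⟫ ≥ s ‖e‖²` and `⟪b, d⟫ ≤ -s ‖d‖²`.
  have hcont : Continuous fun s : ℝ => (c - s • e, A, b + s • d) := by fun_prop
  have htend := (hcont.tendsto 0).mono_left (nhdsWithin_le_nhds (s := Set.Ioi 0))
  simp only [zero_smul, sub_zero, add_zero] at htend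
  obtain ⟨s, hs, hs0⟩ := ((htend.eventually h).and self_mem_nhdsWithin).exists
  have hs0 : (0 : ℝ) < s := hs0
  have h1 := hs.inner_nonneg he
  obtain ⟨u, hu⟩ := hs.1
  have h2 := weak_duality hu hd
  rw [inner_sub_left, real_inner_smul_left, real_inner_self_eq_norm_sq] at h1
  rw [inner_add_left, real_inner_smul_left, real_inner_self_eq_norm_sq, inner_zero_left] at h2
  have h3 : s * (‖e‖ ^ 2 + ‖d‖ ^ 2) ≤ 0 := by linarith
  have h4 : ‖e‖ ^ 2 + ‖d‖ ^ 2 ≤ 0 := nonpos_of_mul_nonpos_right h3 hs0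
  constructor <;> rw [← norm_eq_zero] <;> nlinarith [sq_nonneg ‖e‖, sq_nonneg ‖d‖]

/-- Solutions of programs converging to a stable program subconverge to a solution. -/
theorem LPStable.exists_subseq (h : LPStable I c A b) {q : ℕ → Vec n × Mat m n × Vec m}
    {p : ℕ → Vec n × Vec m} (hq : Tendsto q atTop (𝓝 (c, A, b)))
    (hp : ∀ k, p k ∈ saddleSet I (q k).1 (q k).2.1 (q k).2.2) :
    ∃ p₀ ∈ saddleSet I c A b, ∃ φ : ℕ → ℕ, StrictMono φ ∧ Tendsto (p ∘ φ) atTop (𝓝 p₀) := by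
  by_cases hbdd : ∃ R : ℝ, ∃ᶠ k in atTop, p k ∈ closedBall 0 R
  · obtain ⟨R, hR⟩ := hbdd
    obtain ⟨p₀, -, φ, hφ, hlim⟩ := (isCompact_closedBall _ R).tendsto_subseq' hR
    refine ⟨p₀, ?_, φ, hφ, hlim⟩
    exact (isClosed_setOf_mem_saddleSet I).mem_of_tendsto
      ((hq.comp hφ.tendsto_atTop).prodMk_nhds hlim) (Eventually.of_forall fun k => hp (φ k))
  exfalso
  -- Otherwise the norms diverge, and normalized solutions subconverge to a unit vector of the kind
  -- excluded by `LPStable.eq_zero`.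
  push Not at hbdd
  have hnorm : Tendsto (fun k => ‖p k‖) atTop atTop := by
    refine tendsto_atTop.2 fun R => ?_
    filter_upwards [hbdd R] with k hk
    simpa using (not_le.1 fun hle => hk (by simpa using hle)).le
  have hinv : Tendsto (fun k => ‖p k‖⁻¹) atTop (𝓝 0) := tendsto_inv_atTop_zero.comp hnorm
  have hsphere : ∃ᶠ k in atTop, ‖p k‖⁻¹ • p k ∈ sphere (0 : Vec n × Vec m) 1 := by
    refine Eventually.frequently ?_
    filter_upwards [hnorm.eventually_gt_atTop 0] with k hk
    rw [mem_sphere_zero_iff_norm, norm_smul, norm_inv, norm_norm, inv_mul_cancel₀ hk.ne']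
  obtain ⟨p₀, hp₀, φ, hφ, hlim⟩ := (isCompact_sphere _ 1).tendsto_subseq' hsphere
  have hmem : p₀ ∈ saddleSet I 0 A 0 ∧ inner ℝ c p₀.1 ≤ inner ℝ b p₀.2 := by
    have hqφ := hq.comp hφ.tendsto_atTop
    have hrφ := hinv.comp hφ.tendsto_atTop
    have hc : Tendsto (fun k => ‖p (φ k)‖⁻¹ • (q (φ k)).1) atTop (𝓝 0) := by
      simpa using hrφ.smul hqφ.fst_nhds
    have hb : Tendsto (fun k => ‖p (φ k)‖⁻¹ • (q (φ k)).2.2) atTop (𝓝 0) := by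
      simpa using hrφ.smul hqφ.snd_nhds.snd_nhds
    constructor
    · refine (isClosed_setOf_mem_saddleSet I).mem_of_tendsto
        ((hc.prodMk_nhds (hqφ.snd_nhds.fst_nhds.prodMk_nhds hb)).prodMk_nhds hlim)
        (Eventually.of_forall fun k => ?_)
      obtain ⟨h1, h2, h3⟩ := hp (φ k)
      have hr : (0 : ℝ) ≤ ‖p (φ k)‖⁻¹ := inv_nonneg.2 (norm_nonneg _)
      refine ⟨smul_mem_lpFeasible h1 hr, smul_mem_dualFeasible h2 hr, ?_⟩
      simp only [Function.comp_apply, Prod.smul_fst, Prod.smul_snd, real_inner_smul_left,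
        real_inner_smul_right]
      exact mul_le_mul_of_nonneg_left (mul_le_mul_of_nonneg_left h3 hr) hr
    · refine le_of_tendsto_of_tendsto' (hqφ.fst_nhds.inner hlim.fst_nhds)
        (hqφ.snd_nhds.snd_nhds.inner hlim.snd_nhds) fun k => ?_
      have hr : (0 : ℝ) ≤ ‖p (φ k)‖⁻¹ := inv_nonneg.2 (norm_nonneg _)
      simp only [Function.comp_apply, Prod.smul_fst, Prod.smul_snd, real_inner_smul_right]
      exact mul_le_mul_of_nonneg_left (hp (φ k)).2.2 hr
  obtain ⟨h1, h2⟩ := h.eq_zero hmem.1.1 hmem.1.2.1 hmem.2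
  have : p₀ = 0 := Prod.ext h1 h2
  simp [this] at hp₀

theorem LPStable.lpFinite (h : LPStable I c A b) : LPFinite I c A b :=
  Eventually.self_of_nhds
    (p := fun q : Vec n × Mat m n × Vec m => LPFinite I q.1 q.2.1 q.2.2) h

theorem LPStable.isCompact_saddleSet (h : LPStable I c A b) : IsCompact (saddleSet I c A b) :=
  IsSeqCompact.isCompact fun _ hp => h.exists_subseq (q := fun _ => (c, A, b)) tendsto_const_nhds hp

/-- Upper semicontinuity of the solution set at a stable program. -/
theorem LPStable.eventually_dist_lt (h : LPStable I c A b) {ε : ℝ} (hε : 0 < ε) :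
    ∀ᶠ q : Vec n × Mat m n × Vec m in 𝓝 (c, A, b), ∀ p ∈ saddleSet I q.1 q.2.1 q.2.2,
      ∃ p₀ ∈ saddleSet I c A b, dist p p₀ < ε := by
  by_contra hcon
  obtain ⟨q, hq, hqk⟩ := exists_seq_forall_of_frequently (not_eventually.1 hcon)
  push Not at hqk
  choose p hp hfar using hqk
  obtain ⟨p₀, hp₀, φ, -, hlim⟩ := h.exists_subseq hq hp
  obtain ⟨k, hk⟩ := (hlim.eventually (ball_mem_nhds p₀ hε)).exists
  exact absurd (mem_ball.1 hk) (not_lt.2 (hfar (φ k) p₀ hp₀))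

/-- The space of all data, with its inner product. -/
abbrev LPData (m n : ℕ) : Type := WithLp 2 (Vec n × WithLp 2 (Mat m n × Vec m))

/-- The data `(c, A, b)`. -/
noncomputable def lpData (c : Vec n) (A : Mat m n) (b : Vec m) : LPData m n :=
  WithLp.toLp 2 (c, WithLp.toLp 2 (A, b))

/-- The gradient of the Lagrangian with respect to the data. -/
noncomputable def lagrangianGrad (p : Vec n × Vec m) : LPData m n :=
  lpData p.1 (negOuter p.2 p.1) p.2

theorem lagrangian_eq (c : Vec n) (A : Mat m n) (b : Vec m) (u : Vec n) (v : Vec m) :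
    lagrangian c A b u v = inner ℝ c u + inner ℝ b v - bilin A v u := rfl

/-- Linearity in the data gives the Lagrangian the form `⟪q, θ⟫` required by `clarke_envelope`. -/
theorem inner_lpData (c : Vec n) (A : Mat m n) (b : Vec m) (u : Vec n) (v : Vec m) :
    inner ℝ (lpData c A b) (lagrangianGrad (u, v)) = lagrangian c A b u v := by
  rw [lagrangian_eq, lpData, lagrangianGrad, lpData, WithLp.prod_inner_apply,
    WithLp.prod_inner_apply, inner_negOuter]
  ring

theorem continuous_negOuter :
    Continuous fun p : Vec n × Vec m => negOuter p.2 p.1 := by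
  unfold negOuter
  fun_prop

theorem continuous_lagrangianGrad :
    Continuous (lagrangianGrad : Vec n × Vec m → LPData m n) := by
  have := continuous_negOuter (m := m) (n := n)
  unfold lagrangianGrad lpData
  fun_prop

theorem LipschitzNear.lpData {X : Type*} [PseudoMetricSpace X] {c : X → Vec n} {A : X → Mat m n}
    {b : X → Vec m} {w : X} (hc : LipschitzNear c w) (hA : LipschitzNear A w)
    (hb : LipschitzNear b w) : LipschitzNear (fun x => lpData (c x) (A x) (b x)) w := by
  obtain ⟨K₁, s₁, hs₁, h₁⟩ := hc
  obtain ⟨K₂, s₂, hs₂, h₂⟩ := hA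
  obtain ⟨K₃, s₃, hs₃, h₃⟩ := hb
  refine ⟨K₁ + (K₂ + K₃), s₁ ∩ (s₂ ∩ s₃), inter_mem hs₁ (inter_mem hs₂ hs₃),
    LipschitzOnWith.of_dist_le_mul fun x hx y hy => ?_⟩
  have e₁ := h₁.dist_le_mul x hx.1 y hy.1
  have e₂ := h₂.dist_le_mul x hx.2.1 y hy.2.1
  have e₃ := h₃.dist_le_mul x hx.2.2 y hy.2.2
  have hprod : ∀ {F G : Type} [NormedAddCommGroup F] [NormedAddCommGroup G]
      (z z' : WithLp 2 (F × G)), dist z z' ≤ dist z.fst z'.fst + dist z.snd z'.snd := by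
    intro F G _ _ z z'
    rw [WithLp.prod_dist_eq_of_L2]
    exact Real.sqrt_le_iff.2 ⟨by positivity, by
      nlinarith [mul_nonneg (dist_nonneg (x := z.fst) (y := z'.fst))
        (dist_nonneg (x := z.snd) (y := z'.snd))]⟩
  refine (hprod _ _).trans ((add_le_add_right (hprod _ _) _).trans ?_)
  push_cast
  change dist (c x) (c y) + (dist (A x) (A y) + dist (b x) (b y)) ≤ _
  linarith

/-- The increment of the optimal value is bounded by that of the Lagrangian at an old primal and a
new dual solution. -/
theorem lpValue_sub_le {c' : Vec n} {A' : Mat m n} {b' : Vec m} {p p' : Vec n × Vec m}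
    (hp : p ∈ saddleSet I c A b) (hp' : p' ∈ saddleSet I c' A' b') :
    lpValue I c' A' b' - lpValue I c A b ≤
      inner ℝ (lpData c' A' b' - lpData c A b) (lagrangianGrad (p.1, p'.2)) := by
  rw [inner_sub_left, inner_lpData, inner_lpData, lpValue_eq_of_mem_saddleSet hp,
    lpValue_eq_of_mem_saddleSet hp', inner_eq_of_mem_saddleSet hp', lagrangian_eq, lagrangian_eq]
  -- At `(p.1, p'.2)` the new Lagrangian is at least the new dual value, and the old one at most the
  -- old primal value.
  have h1 := bilin_le_inner hp'.2.1 hp.1.1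
  have h2 := inner_le_bilin hp.1 hp'.2.1.1
  linarith

variable {E : Type*} [NormedAddCommGroup E] [InnerProductSpace ℝ E] [CompleteSpace E]

theorem clarke_lagrangian_subset {c : E → Vec n} {A : E → Mat m n} {b : E → Vec m} {w : E}
    {c' : E →L[ℝ] Vec n} {A' : E →L[ℝ] Mat m n} {b' : E →L[ℝ] Vec m}
    (hc : HasStrictFDerivAt c c' w) (hA : HasStrictFDerivAt A A' w)
    (hb : HasStrictFDerivAt b b' w) (u : Vec n) (v : Vec m) :
    clarke (fun x => lagrangian (c x) (A x) (b x) u v) w ⊆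
      {ContinuousLinearMap.adjoint c' u + ContinuousLinearMap.adjoint b' v
        + ContinuousLinearMap.adjoint A' (negOuter v u)} := by
  refine clarke_subset_of_hasStrictFDerivAt ?_
  have h := ((hasStrictFDerivAt_inner_const hc u).add (hasStrictFDerivAt_inner_const hb v)).add
    (hasStrictFDerivAt_inner_const hA (negOuter v u))
  rw [map_add, map_add]
  have heq : (fun x => lagrangian (c x) (A x) (b x) u v) = ((fun x => inner ℝ (c x) u)
      + fun x => inner ℝ (b x) v) + fun x => inner ℝ (A x) (negOuter v u) := by
    funext x
    simp [lagrangian_eq, inner_negOuter, sub_eq_add_neg]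
  rw [heq]
  exact h

/-- Sensitivity of the optimal value of a stable linear program to all of the data. -/
theorem LPStable.clarke_subset [FiniteDimensional ℝ E] {c : E → Vec n} {A : E → Mat m n}
    {b : E → Vec m} {w : E} {Z : E → ℝ} (hc : LipschitzNear c w) (hA : LipschitzNear A w)
    (hb : LipschitzNear b w) (h : LPStable I (c w) (A w) (b w))
    (hZ : ∀ᶠ x in 𝓝 w, Z x = lpValue I (c x) (A x) (b x)) :
    LipschitzNear Z w ∧ (clarke Z w).Nonempty ∧ clarke Z w ⊆ convexHull ℝ
      (⋃ u ∈ primalSolutions I (c w) (A w) (b w), ⋃ v ∈ dualSolutions I (c w) (A w) (b w),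
        clarke (fun x => lagrangian (c x) (A x) (b x) u v) w) := by
  have hq : Tendsto (fun x => (c x, A x, b x)) (𝓝 w) (𝓝 (c w, A w, b w)) :=
    hc.continuousAt.tendsto.prodMk_nhds (hA.continuousAt.tendsto.prodMk_nhds hb.continuousAt)
  have hK := h.isCompact_saddleSet
  obtain ⟨hlip, hne, hsub⟩ := clarke_envelope (Z := Z) (LipschitzNear.lpData hc hA hb)
    (hK.image continuous_lagrangianGrad) (fun ε hε => by
      obtain ⟨δ, hδ, hunif⟩ := Metric.mem_uniformity_dist.1
        (hK.uniformContinuousAt_of_continuousAt _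
          (fun p _ => continuous_lagrangianGrad.continuousAt) (dist_mem_uniformity hε))
      have hev : ∀ᶠ x in 𝓝 w, Z x = lpValue I (c x) (A x) (b x) ∧
          LPFinite I (c x) (A x) (b x) ∧ ∀ p ∈ saddleSet I (c x) (A x) (b x),
            ∃ p₀ ∈ saddleSet I (c w) (A w) (b w), dist p p₀ < δ :=
        hZ.and ((hq.eventually h).and (hq.eventually (h.eventually_dist_lt hδ)))
      filter_upwards [prod_mem_nhds hev hev] with z hz
      obtain ⟨⟨hZx, hx, hdx⟩, ⟨hZy, hy, hdy⟩⟩ := hz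
      obtain ⟨p, hp⟩ := hx.saddleSet_nonempty
      obtain ⟨p', hp'⟩ := hy.saddleSet_nonempty
      obtain ⟨p₀, hp₀, hd⟩ := hdx p hp
      obtain ⟨p₀', hp₀', hd'⟩ := hdy p' hp'
      -- The old primal and new dual solutions are replaced by nearby solutions at `w`; uniform
      -- continuity of `lagrangianGrad` makes this cost the `ε` term.
      have hmem : (p₀.1, p₀'.2) ∈ saddleSet I (c w) (A w) (b w) := by
        rw [h.lpFinite.saddleSet_eq] at hp₀ hp₀' ⊢
        exact ⟨hp₀.1, hp₀'.2⟩
      refine ⟨_, ⟨_, hmem, rfl⟩, ?_⟩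
      have hdist : dist (p₀.1, p₀'.2) (p.1, p'.2) < δ := by
        rw [Prod.dist_eq, dist_comm p₀.1, dist_comm p₀'.2]
        exact max_lt ((le_max_left _ _).trans_lt hd) ((le_max_right _ _).trans_lt hd')
      have h1 := hunif hdist hmem
      have h2 := lpValue_sub_le hp hp'
      rw [hZx, hZy]
      refine h2.trans ?_
      rw [← sub_le_iff_le_add', ← inner_sub_right, mul_comm]
      refine (real_inner_le_norm _ _).trans (mul_le_mul_of_nonneg_left ?_ (norm_nonneg _))
      rw [← dist_eq_norm, dist_comm]
      exact h1.le)
  refine ⟨hlip, hne, hsub.trans (convexHull_mono ?_)⟩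
  simp only [Set.iUnion_subset_iff, Set.mem_image]
  rintro _ ⟨⟨u, v⟩, hp, rfl⟩
  rw [h.lpFinite.saddleSet_eq] at hp
  simp only [inner_lpData]
  exact fun g hg => Set.mem_biUnion hp.1 (Set.mem_biUnion hp.2 hg)

end Stability

/-! ### Sensitivity to the matrix, with equality in standard form. -/

section StandardForm

open Filter Metric

/-- Every linear functional is close, on a compact set, to one with a unique maximizer there. -/
theorem IsCompact.exists_unique_maximizer {H : Type*} [NormedAddCommGroup H]
    [InnerProductSpace ℝ H] {K : Set H} (hK : IsCompact K) (a : H) {x₀ : H} (hx₀ : x₀ ∈ K) {δ : ℝ}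
    (hδ : 0 < δ) : ∃ p : H, ∃ z ∈ K, (∀ x ∈ K, inner ℝ p x ≤ inner ℝ p z) ∧
      (∀ x ∈ K, inner ℝ p z ≤ inner ℝ p x → x = z) ∧ inner ℝ a x₀ - δ ≤ inner ℝ a z := by
  obtain ⟨R, hR0, hR⟩ := hK.isBounded.exists_pos_norm_le
  -- Let `z` maximize `⟪a, x⟫ + t ‖x‖²` on `K`. Linearizing the square at `z` leaves a gap `t ‖x -
  -- z‖²`, so `z` is the unique maximizer of the linear part; the square itself costs at most `t * R
  -- ^ 2 = δ`.
  set t := δ / R ^ 2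
  have ht : 0 < t := by positivity
  have hcont : Continuous fun x : H => inner ℝ a x + t * ‖x‖ ^ 2 := by fun_prop
  obtain ⟨z, hz, hmax⟩ := hK.exists_isMaxOn ⟨x₀, hx₀⟩ hcont.continuousOn
  have hquad : ∀ x ∈ K, inner ℝ (a + (2 * t) • z) x + t * ‖x - z‖ ^ 2
      ≤ inner ℝ (a + (2 * t) • z) z := by
    intro x hx
    have h1 : inner ℝ a x + t * ‖x‖ ^ 2 ≤ inner ℝ a z + t * ‖z‖ ^ 2 := hmax hx
    rw [inner_add_left, inner_add_left, real_inner_smul_left, real_inner_smul_left,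
      norm_sub_sq_real, real_inner_self_eq_norm_sq, real_inner_comm x z]
    linarith
  refine ⟨a + (2 * t) • z, z, hz, fun x hx => ?_, fun x hx hle => ?_, ?_⟩
  · have := hquad x hx
    have h0 : 0 ≤ t * ‖x - z‖ ^ 2 := by positivity
    linarith
  · have h1 := hquad x hx
    have h2 : ‖x - z‖ ^ 2 ≤ 0 := nonpos_of_mul_nonpos_right (by linarith) ht
    rw [← sub_eq_zero, ← norm_eq_zero]
    exact pow_eq_zero_iff two_ne_zero |>.1 (le_antisymm h2 (sq_nonneg _))
  · have h1 : inner ℝ a x₀ + t * ‖x₀‖ ^ 2 ≤ inner ℝ a z + t * ‖z‖ ^ 2 := hmax hx₀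
    have h2 : t * ‖z‖ ^ 2 ≤ δ := by
      calc t * ‖z‖ ^ 2 ≤ t * R ^ 2 := by gcongr; exact hR z hz
        _ = δ := by simp only [t]; field_simp
    have h3 : 0 ≤ t * ‖x₀‖ ^ 2 := by positivity
    linarith

variable {m n : ℕ} {c : Vec n} {A : Mat m n} {b : Vec m}

theorem bilin_add_left (A B : Mat m n) (v : Vec m) (u : Vec n) :
    bilin (A + B) v u = bilin A v u + bilin B v u := by
  simp [bilin, mul_add, add_mul, Finset.sum_add_distrib]

theorem bilin_smul_left (s : ℝ) (A : Mat m n) (v : Vec m) (u : Vec n) :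
    bilin (s • A) v u = s * bilin A v u := by
  simp only [bilin, Finset.mul_sum]
  exact Finset.sum_congr rfl fun i _ => Finset.sum_congr rfl fun j _ => by simp; ring

theorem bilin_negOuter (y v : Vec m) (x u : Vec n) :
    bilin (negOuter y x) v u = -(inner ℝ y v * inner ℝ x u) := by
  rw [inner_vec, inner_vec, Finset.sum_mul_sum, ← Finset.sum_neg_distrib, bilin]
  refine Finset.sum_congr rfl fun i _ => ?_
  rw [← Finset.sum_neg_distrib]
  exact Finset.sum_congr rfl fun j _ => by simp [negOuter]; ring

theorem continuous_bilin (A : Mat m n) :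
    Continuous fun p : Vec n × Vec m => bilin A p.2 p.1 := by
  unfold bilin
  fun_prop

theorem exists_inner_eq_bilin (A : Mat m n) (v : Vec m) :
    ∃ a : Vec n, ∀ u, inner ℝ a u = bilin A v u :=
  ⟨WithLp.toLp 2 fun j => ∑ i, A (i, j) * v i, fun u => by rw [inner_vec, bilin_eq_right]⟩

theorem exists_inner_eq_bilin' (A : Mat m n) (u : Vec n) :
    ∃ a : Vec m, ∀ v, inner ℝ a v = bilin A v u :=
  ⟨WithLp.toLp 2 fun i => ∑ j, A (i, j) * u j, fun v => by
    rw [inner_vec, bilin_eq_left]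
    exact Finset.sum_congr rfl fun i _ => mul_comm _ _⟩

/-- In standard form the constraints are equations, which determine the bilinear form. -/
theorem bilin_eq_inner {u : Vec n} (hu : u ∈ lpFeasible ∅ A b) (v : Vec m) :
    bilin A v u = inner ℝ b v := by
  rw [bilin_eq_left, inner_vec]
  refine Finset.sum_congr rfl fun i _ => ?_
  rw [hu.2.2 i (by simp), mul_comm]

/-- A matrix with prescribed images of `u` and, under the transpose, of `v`. -/
theorem exists_bilin_eq {u p : Vec n} {v r : Vec m} (hu : u ≠ 0)
    (hpr : inner ℝ p u = inner ℝ r v) : ∃ D : Mat m n, (∀ v', bilin D v' u = -inner ℝ r v') ∧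
      (v ≠ 0 → ∀ u', bilin D v u' = -inner ℝ p u') := by
  have hu' : inner ℝ u u ≠ 0 := inner_self_ne_zero.2 hu
  -- Two rank-one terms prescribe the images and the third removes their overlap, consistently by
  -- `hpr`. For `v = 0` the inverse is `0` and only the first term remains.
  refine ⟨(inner ℝ u u)⁻¹ • negOuter r u + (inner ℝ v v)⁻¹ • negOuter v p
    + (-(inner ℝ r v * (inner ℝ u u)⁻¹ * (inner ℝ v v)⁻¹)) • negOuter v u,
    fun v' => ?_, fun hv u' => ?_⟩
  · simp only [bilin_add_left, bilin_smul_left, bilin_negOuter, hpr]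
    field_simp
    ring
  · have hv' : inner ℝ v v ≠ 0 := inner_self_ne_zero.2 hv
    simp only [bilin_add_left, bilin_smul_left, bilin_negOuter]
    field_simp
    ring

/-- Perturbing the matrix in the direction `D` selects solutions at which the bilinear form of `D`
satisfies a saddle inequality. -/
theorem bilin_le_bilin_of_perturbation {I : Set (Fin m)} {D : Mat m n} {s : ℝ} (hs : 0 < s)
    {p p₀ : Vec n × Vec m} (hp : p ∈ saddleSet I c (A + s • D) b) (hp₀ : p₀ ∈ saddleSet I c A b) :
    bilin D p.2 p₀.1 ≤ bilin D p₀.2 p.1 := by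
  -- Each primal solution is tested against the dual solution of the other program.
  have h1 := inner_le_bilin hp.1 hp₀.2.1.1
  have h2 := bilin_le_inner hp₀.2.1 hp.1.1
  have h3 := inner_le_bilin hp₀.1 hp.2.1.1
  have h4 := bilin_le_inner hp.2.1 hp₀.1.1
  have h5 := hp.2.2
  have h6 := hp₀.2.2
  rw [bilin_add_left, bilin_smul_left] at h1 h4
  have : s * bilin D p.2 p₀.1 ≤ s * bilin D p₀.2 p.1 := by linarith
  exact le_of_mul_le_mul_left this hs

theorem lipschitzNear_const {X Y : Type*} [PseudoMetricSpace X] [PseudoMetricSpace Y] (y : Y)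
    (w : X) : LipschitzNear (fun _ => y) w :=
  ⟨0, Set.univ, univ_mem, (LipschitzWith.const y).lipschitzOnWith⟩

theorem lipschitzNear_id {X : Type*} [PseudoMetricSpace X] (w : X) :
    LipschitzNear (fun x => x) w :=
  ⟨1, Set.univ, univ_mem, LipschitzWith.id.lipschitzOnWith⟩

/-- Sensitivity of the optimal value of a stable linear program to the matrix. -/
theorem LPStable.clarke_mat_subset {I : Set (Fin m)} (h : LPStable I c A b) :
    LipschitzNear (fun X => lpValue I c X b) A ∧ (clarke (fun X => lpValue I c X b) A).Nonempty ∧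
      clarke (fun X => lpValue I c X b) A ⊆ convexHull ℝ
        {M | ∃ v ∈ dualSolutions I c A b, ∃ u ∈ primalSolutions I c A b, M = negOuter v u} := by
  obtain ⟨h1, h2, h3⟩ := LPStable.clarke_subset (c := fun _ => c) (A := fun X => X)
    (b := fun _ => b) (lipschitzNear_const c A) (lipschitzNear_id A) (lipschitzNear_const b A) h
    (Eventually.of_forall fun X => rfl)
  refine ⟨h1, h2, h3.trans (convexHull_mono ?_)⟩
  refine Set.iUnion₂_subset fun u hu => Set.iUnion₂_subset fun v hv => ?_
  refine (clarke_lagrangian_subset (hasStrictFDerivAt_const c A) (hasStrictFDerivAt_id A)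
    (hasStrictFDerivAt_const b A) u v).trans ?_
  rw [Set.singleton_subset_iff]
  refine ⟨v, hv, u, hu, ?_⟩
  refine ext_inner_right ℝ fun M => ?_
  simp [ContinuousLinearMap.adjoint_inner_left]

/-- Uniquely exposed pairs of solutions give generalized gradients with respect to the matrix. -/
theorem LPStable.negOuter_mem_clarke_of_exposed (h : LPStable ∅ c A b) (hb : b ≠ 0)
    {u p : Vec n} {v r : Vec m} (hu : u ∈ primalSolutions ∅ c A b)
    (hv : v ∈ dualSolutions ∅ c A b)
    (hp : ∀ u' ∈ primalSolutions ∅ c A b, inner ℝ p u' ≤ inner ℝ p u)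
    (hpu : ∀ u' ∈ primalSolutions ∅ c A b, inner ℝ p u ≤ inner ℝ p u' → u' = u)
    (hr : ∀ v' ∈ dualSolutions ∅ c A b, inner ℝ r v' ≤ inner ℝ r v)
    (hrv : ∀ v' ∈ dualSolutions ∅ c A b, inner ℝ r v ≤ inner ℝ r v' → v' = v) :
    negOuter v u ∈ clarke (fun X => lpValue ∅ c X b) A := by
  have hu0 : u ≠ 0 := by
    rintro rfl
    refine hb (PiLp.ext fun i => ?_)
    simpa using (hu.1.2.2 i (by simp)).symm
  have hbb : inner ℝ b b ≠ 0 := inner_self_ne_zero.2 hb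
  have hset := h.lpFinite.saddleSet_eq
  -- Since `A u' = b` on the feasible set, `a` is constant there. The shift from `-p` to `a - p`
  -- thus exposes the same point and meets the compatibility condition for `D`; this uses the
  -- standard form and `b ≠ 0`.
  obtain ⟨a, ha⟩ := exists_inner_eq_bilin A (((inner ℝ r v + inner ℝ p u) / inner ℝ b b) • b)
  have ha' : ∀ u' ∈ primalSolutions ∅ c A b, inner ℝ (a - p) u'
      = inner ℝ r v + (inner ℝ p u - inner ℝ p u') := by
    intro u' hu'
    rw [inner_sub_left, ha, bilin_eq_inner hu'.1, real_inner_smul_right]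
    field_simp
    ring
  obtain ⟨D, hD₁, hD₂⟩ := exists_bilin_eq (p := a - p) (r := r) (v := v) hu0
    (by rw [ha' u hu, sub_self, add_zero])
  have hcont : Continuous fun s : ℝ => A + s • D := by fun_prop
  have hA : Tendsto (fun s : ℝ => A + s • D) (𝓝[>] 0) (𝓝 A) := by
    simpa using (hcont.tendsto 0).mono_left nhdsWithin_le_nhds
  have hdata : Tendsto (fun s : ℝ => (c, A + s • D, b)) (𝓝[>] 0) (𝓝 (c, A, b)) :=
    tendsto_const_nhds.prodMk_nhds (hA.prodMk_nhds tendsto_const_nhds)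
  have hclose : ∀ ε > 0, ∀ᶠ s : ℝ in 𝓝[>] 0, ∀ z ∈ saddleSet ∅ c (A + s • D) b,
      dist (negOuter z.2 z.1) (negOuter v u) < ε := by
    intro ε hε
    by_contra hcon
    obtain ⟨s, hs, hsk⟩ := exists_seq_forall_of_frequently
      ((not_eventually.1 hcon).and_eventually self_mem_nhdsWithin)
    push Not at hsk
    choose hz hpos using hsk
    choose z hz hfar using hz
    obtain ⟨z₀, hz₀, φ, -, hlim⟩ := h.exists_subseq (hdata.comp hs) hz
    have hle : bilin D z₀.2 u ≤ bilin D v z₀.1 := by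
      refine le_of_tendsto_of_tendsto'
        (((continuous_bilin D).tendsto (u, z₀.2)).comp
          (tendsto_const_nhds.prodMk_nhds hlim.snd_nhds))
        (((continuous_bilin D).tendsto (z₀.1, v)).comp
          (hlim.fst_nhds.prodMk_nhds tendsto_const_nhds)) fun k => ?_
      exact bilin_le_bilin_of_perturbation (p₀ := (u, v)) (hpos (φ k)) (hz (φ k))
        (hset ▸ ⟨hu, hv⟩)
    rw [hset] at hz₀
    have heq : negOuter z₀.2 z₀.1 = negOuter v u := by
      -- For `v ≠ 0` the saddle inequality says that the losses of `r` at `z₀.2` and of `p` at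
      -- `z₀.1` sum to at most `0`, so both vanish. For `v = 0` only the dual part is determined,
      -- but then the outer product is zero anyway.
      rw [hD₁] at hle
      by_cases hv0 : v = 0
      · have hzero : z₀.2 = v := hrv _ hz₀.2 (by
          simp only [hv0, inner_zero_right]
          simp only [hv0, bilin, PiLp.zero_apply, zero_mul, Finset.sum_const_zero] at hle
          linarith)
        ext i
        simp [negOuter, hzero, hv0]
      · rw [hD₂ hv0, ha' _ hz₀.1] at hle
        have h1 := hp _ hz₀.1
        have h2 := hr _ hz₀.2
        rw [hpu _ hz₀.1 (by linarith), hrv _ hz₀.2 (by linarith)]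
    have hlim' := (continuous_negOuter.tendsto z₀).comp hlim
    rw [heq] at hlim'
    obtain ⟨k, hk⟩ := (hlim'.eventually (ball_mem_nhds _ hε)).exists
    exact absurd (mem_ball.1 hk) (not_lt.2 (hfar (φ k)))
  have hgrad : ∀ k : ℕ, ∃ X g, dist X A < 1 / ((k : ℝ) + 1) ∧
      g ∈ clarke (fun X => lpValue ∅ c X b) X ∧ dist g (negOuter v u) ≤ 1 / ((k : ℝ) + 1) := by
    intro k
    have hk : (0 : ℝ) < 1 / ((k : ℝ) + 1) := Nat.one_div_pos_of_nat
    have hstab : ∀ᶠ s : ℝ in 𝓝[>] 0, LPStable ∅ c (A + s • D) b :=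
      hdata.eventually (Eventually.eventually_nhds h)
    obtain ⟨s, h1, h2, h3⟩ := (hstab.and ((hclose _ hk).and
      (hA.eventually (ball_mem_nhds A hk)))).exists
    obtain ⟨-, ⟨g, hg⟩, hsub⟩ := h1.clarke_mat_subset
    refine ⟨A + s • D, g, h3, hg, ?_⟩
    refine convexHull_min ?_ (convex_closedBall (negOuter v u) (1 / ((k : ℝ) + 1))) (hsub hg)
    rintro _ ⟨v', hv', u', hu', rfl⟩
    exact (h2 (u', v') (h1.lpFinite.saddleSet_eq ▸ ⟨hu', hv'⟩)).le
  choose X g hX hg hgd using hgrad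
  refine mem_clarke_of_tendsto h.clarke_mat_subset.1 (x := X) (c := g) ?_ ?_ hg
  · exact tendsto_iff_dist_tendsto_zero.2 (squeeze_zero (fun _ => dist_nonneg)
      (fun k => (hX k).le) tendsto_one_div_add_atTop_nhds_zero_nat)
  · exact tendsto_iff_dist_tendsto_zero.2 (squeeze_zero (fun _ => dist_nonneg)
      hgd tendsto_one_div_add_atTop_nhds_zero_nat)

/-- In standard form every pair of solutions gives a generalized gradient with respect to the
matrix. -/
theorem LPStable.negOuter_mem_clarke (h : LPStable ∅ c A b) {u : Vec n} {v : Vec m}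
    (hu : u ∈ primalSolutions ∅ c A b) (hv : v ∈ dualSolutions ∅ c A b) :
    negOuter v u ∈ clarke (fun X => lpValue ∅ c X b) A := by
  obtain ⟨hlip, ⟨g, hg⟩, hsub⟩ := h.clarke_mat_subset
  have hset := h.lpFinite.saddleSet_eq
  -- For `b = 0` stability leaves only the primal solution `0`, so every outer product is zero and
  -- nonemptiness suffices.
  by_cases hb : b = 0
  · subst hb
    have hzero : ∀ u ∈ primalSolutions ∅ c A 0, u = 0 := by
      intro u hu
      refine (h.eq_zero (d := 0) hu.1 ⟨by simp, by simp⟩ ?_).1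
      have h0 : (0 : Vec n) ∈ lpFeasible ∅ A 0 := ⟨by simp, by simp, by simp⟩
      simpa using hu.2 0 h0
    have hneg : ∀ v : Vec m, negOuter v (0 : Vec n) = 0 := fun v => by
      ext i
      simp [negOuter]
    have hg0 : g ∈ ({0} : Set (Mat m n)) := by
      refine convexHull_min ?_ (convex_singleton 0) (hsub hg)
      rintro _ ⟨v, -, u, hu, rfl⟩
      rw [hzero u hu, hneg]
      rfl
    rw [hzero u hu, hneg, ← Set.mem_singleton_iff.1 hg0]
    exact hg
  have hcompact := h.isCompact_saddleSet
  rw [hset] at hcompact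
  have hU : IsCompact (primalSolutions ∅ c A b) := by
    have := hcompact.image continuous_fst
    rwa [Set.fst_image_prod _ ⟨v, hv⟩] at this
  have hV : IsCompact (dualSolutions ∅ c A b) := by
    have := hcompact.image continuous_snd
    rwa [Set.snd_image_prod ⟨u, hu⟩] at this
  refine mem_of_forall_inner_le (convex_convexHull ℝ _) (isCompact_clarke hlip).isClosed
    fun M S hS => le_of_forall_pos_le_add fun ε hε => ?_
  -- The support functional is bilinear in `(u, v)`: an exposed `ū` is chosen for fixed `v`, then an
  -- exposed `w` for fixed `ū`, each losing `ε / 2`.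
  obtain ⟨a₁, ha₁⟩ := exists_inner_eq_bilin M v
  obtain ⟨p, ū, hū, hp, hpu, hle₁⟩ := hU.exists_unique_maximizer (-a₁) hu (half_pos hε)
  obtain ⟨a₂, ha₂⟩ := exists_inner_eq_bilin' M ū
  obtain ⟨r, w, hw, hr, hrw, hle₂⟩ := hV.exists_unique_maximizer (-a₂) hv (half_pos hε)
  have hS' := hS _ (h.negOuter_mem_clarke_of_exposed hb hū hw hp hpu hr hrw)
  rw [real_inner_comm, inner_negOuter] at hS' ⊢
  rw [inner_neg_left, inner_neg_left, ha₁, ha₁] at hle₁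
  rw [inner_neg_left, inner_neg_left, ha₂, ha₂] at hle₂
  linarith

end StandardForm

/-! ### Straight-line programs for sums of products. -/

section ArithmeticPrograms

/-- The program that adds (or subtracts, if `neg`) the products of the listed pairs of registers to
the accumulators `acc`. -/
def multiplyAccumulate {κ : Type} [DecidableEq κ] (neg : Bool) :
    {ι : Type} → List (κ × ι × ι) → (κ → ι) → ArithProgram κ ι
  | _, [], acc => .output acc
  | _, (k, i, j) :: l, acc => .mul i j <|
      let next := multiplyAccumulate neg
        -- A product and an accumulation each add a register, so old registers are shifted twice and
        -- `none` holds the new accumulator.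
        (l.map fun p => (p.1, some (some p.2.1), some (some p.2.2)))
        (Function.update (fun k => some (some (acc k))) k none)
      if neg then .sub (some (acc k)) none next else .add (some (acc k)) none next
termination_by _ l => l.length

theorem time_multiplyAccumulate {κ : Type} [DecidableEq κ] (neg : Bool) {ι : Type}
    (l : List (κ × ι × ι)) (acc : κ → ι) :
    (multiplyAccumulate neg l acc).time = 2 * l.length := by
  induction hk : l.length generalizing ι with
  | zero =>
    obtain rfl := List.length_eq_zero_iff.1 hk
    simp [multiplyAccumulate, ArithProgram.time]
  | succ k ih =>
    match l, hk with
    | (a, i, j) :: l, hk =>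
      have := ih (l.map fun p => (p.1, some (some p.2.1), some (some p.2.2)))
        (Function.update (fun k => some (some (acc k))) a none) (by simpa using hk)
      rw [multiplyAccumulate]
      cases neg <;> simp [ArithProgram.time, this] <;> ring

theorem eval_multiplyAccumulate {κ : Type} [DecidableEq κ] (neg : Bool) {ι : Type}
    (l : List (κ × ι × ι)) (acc : κ → ι) (x : ι → ℝ) (k : κ) :
    (multiplyAccumulate neg l acc).eval x k = x (acc k) + (if neg then -1 else 1) *
      (l.map fun p => if p.1 = k then x p.2.1 * x p.2.2 else 0).sum := by
  induction hN : l.length generalizing ι with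
  | zero =>
    obtain rfl := List.length_eq_zero_iff.1 hN
    simp [multiplyAccumulate, ArithProgram.eval]
  | succ N ih =>
    match l, hN with
    | (a, i, j) :: l, hN =>
      have := ih (l.map fun p => (p.1, some (some p.2.1), some (some p.2.2)))
        (Function.update (fun k => some (some (acc k))) a none)
        (fun o => o.elim (x (acc a) + (if neg then -1 else 1) * (x i * x j))
          fun o => o.elim (x i * x j) x) (by simpa using hN)
      simp only [List.map_map, Function.comp_def, Option.elim_some] at this
      rw [multiplyAccumulate]
      by_cases hk : a = k
      · subst hk
        cases neg
        · simp [ArithProgram.eval] at this ⊢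
          rw [this]
          ring
        · simp [ArithProgram.eval] at this ⊢
          rw [sub_eq_add_neg, this]
          ring
      · have hk' : k ≠ a := Ne.symm hk
        cases neg
        · simp [ArithProgram.eval, hk, hk'] at this ⊢
          rw [this]
        · simp [ArithProgram.eval, hk, hk'] at this ⊢
          rw [sub_eq_add_neg, this]

/-- The program computing the sums (or, if `neg`, minus the sums) of the products of pairs of
registers indexed by `τ`. -/
noncomputable def sumOfProducts {κ ι τ : Type} [DecidableEq κ] [Fintype τ] (neg : Bool)
    (f : τ → κ × ι × ι) : ArithProgram κ ι :=
  -- One zero register initializes all accumulators; it is the `+ 1` in the running time.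
  .const 0 (multiplyAccumulate neg
    (Finset.univ.toList.map fun t => ((f t).1, some (f t).2.1, some (f t).2.2)) fun _ => none)

theorem time_sumOfProducts {κ ι τ : Type} [DecidableEq κ] [Fintype τ] (neg : Bool)
    (f : τ → κ × ι × ι) : (sumOfProducts neg f).time = 2 * Fintype.card τ + 1 := by
  simp [sumOfProducts, ArithProgram.time, time_multiplyAccumulate]

theorem eval_sumOfProducts {κ ι τ : Type} [DecidableEq κ] [Fintype τ] (neg : Bool)
    (f : τ → κ × ι × ι) (x : ι → ℝ) (k : κ) :
    (sumOfProducts neg f).eval x k = (if neg then -1 else 1) *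
      ∑ t, if (f t).1 = k then x (f t).2.1 * x (f t).2.2 else 0 := by
  simp [sumOfProducts, ArithProgram.eval, eval_multiplyAccumulate, Function.comp_def,
    Finset.sum_map_toList]

end ArithmeticPrograms

/-! ### The programs for the three cases, and the theorem. -/

section Programs

open Filter

/-- The program multiplying a transposed Jacobian matrix with a vector. -/
noncomputable def jacobianProgram (d n : ℕ) :
    ArithProgram (Fin d) ((Fin n × Fin d) ⊕ Fin n) :=
  sumOfProducts false fun t : Fin n × Fin d => (t.2, .inl t, .inr t.1)

theorem eval_jacobianProgram {d n : ℕ} (f' : Vec d →L[ℝ] Vec n) (u : Vec n) :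
    WithLp.toLp 2 ((jacobianProgram d n).eval (Sum.elim (jacobian f') u))
      = ContinuousLinearMap.adjoint f' u := by
  ext k
  have h : ContinuousLinearMap.adjoint f' u k
      = inner ℝ (ContinuousLinearMap.adjoint f' u) (EuclideanSpace.single k 1) := by
    simp [EuclideanSpace.inner_single_right]
  rw [h, ContinuousLinearMap.adjoint_inner_left, inner_vec]
  simp only [jacobianProgram, eval_sumOfProducts, Sum.elim_inl, Sum.elim_inr, jacobian,
    Fintype.sum_prod_type, Finset.sum_ite_eq', Finset.mem_univ, if_true]
  simp [mul_comm]

/-- The program computing the matrix `- v uᵀ`. -/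
noncomputable def negOuterProgram (m n : ℕ) : ArithProgram (Fin m × Fin n) (Fin m ⊕ Fin n) :=
  sumOfProducts true fun t : Fin m × Fin n => (t, .inl t.1, .inr t.2)

theorem eval_negOuterProgram {m n : ℕ} (v : Vec m) (u : Vec n) :
    WithLp.toLp 2 ((negOuterProgram m n).eval (Sum.elim v u)) = negOuter v u := by
  ext k
  simp [negOuterProgram, eval_sumOfProducts, negOuter]

theorem CombinatorialProblem.EquivalentLP.eventually {d m n : ℕ} {P : CombinatorialProblem d}
    {I : Set (Fin m)} {c : Vec d → Vec n} {A : Vec d → Mat m n} {b : Vec d → Vec m}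
    (h : P.EquivalentLP I c A b) {w : Vec d} (hw : w ∈ interior P.W) :
    ∀ᶠ x in 𝓝 w, IsOptimalValue (lpFeasible I (A x) (b x)) (c x) (P.value x) :=
  Filter.mem_of_superset (mem_interior_iff_mem_nhds.1 hw) h

end Programs

theorem theorem1 (d n m : ℕ) :
    ∃ (G₁ : ArithProgram (Fin d) ((Fin n × Fin d) ⊕ Fin n))
      (G₂ : ArithProgram (Fin d) ((Fin m × Fin d) ⊕ Fin m))
      (G₃ : ArithProgram (Fin m × Fin n) (Fin m ⊕ Fin n)),
      G₁.time ≤ 2 * d * n + 1 ∧ G₂.time ≤ 2 * d * m + 1 ∧ G₃.time ≤ 2 * m * n + 1 ∧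
      ∀ (P : CombinatorialProblem d) (w : Vec d), w ∈ interior P.W →
      ∀ (I : Set (Fin m)),
        -- the parameter enters only the cost vector
        (∀ (c : Vec d → Vec n) (A : Mat m n) (b : Vec m), PrimalEfficient P I c A b →
          LipschitzNear P.value w ∧ (clarke P.value w).Nonempty ∧
          clarke P.value w ⊆ convexHull ℝ
            (⋃ u ∈ primalSolutions I (c w) A b, clarke (fun x => inner ℝ (c x) u) w) ∧
          ∀ c' : Vec d →L[ℝ] Vec n, HasStrictFDerivAt c c' w →
            clarke P.value w
              = (fun u => ContinuousLinearMap.adjoint c' u) '' primalSolutions I (c w) A b ∧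
            clarke P.value w
              = (fun u : Vec n => WithLp.toLp 2 (G₁.eval (Sum.elim (jacobian c') u))) ''
                  primalSolutions I (c w) A b) ∧
        -- the parameter enters only the right-hand side
        (∀ (c : Vec n) (A : Mat m n) (b : Vec d → Vec m), DualEfficient P I c A b →
          LipschitzNear P.value w ∧ (clarke P.value w).Nonempty ∧
          clarke P.value w ⊆ convexHull ℝ
            (⋃ v ∈ dualSolutions I c A (b w), clarke (fun x => inner ℝ (b x) v) w) ∧
          ∀ b' : Vec d →L[ℝ] Vec m, HasStrictFDerivAt b b' w →
            clarke P.value w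
              = (fun v => ContinuousLinearMap.adjoint b' v) '' dualSolutions I c A (b w) ∧
            clarke P.value w
              = (fun v : Vec m => WithLp.toLp 2 (G₂.eval (Sum.elim (jacobian b') v))) ''
                  dualSolutions I c A (b w)) ∧
        -- the parameter enters all of the data
        (∀ (c : Vec d → Vec n) (A : Vec d → Mat m n) (b : Vec d → Vec m),
          PrimalDualEfficient P I c A b → LPStable I (c w) (A w) (b w) →
          -- generalized gradients with respect to the matrix
          LipschitzNear (fun X => lpValue I (c w) X (b w)) (A w) ∧
          (clarke (fun X => lpValue I (c w) X (b w)) (A w)).Nonempty ∧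
          clarke (fun X => lpValue I (c w) X (b w)) (A w) ⊆ convexHull ℝ
            {M | ∃ v ∈ dualSolutions I (c w) (A w) (b w),
              ∃ u ∈ primalSolutions I (c w) (A w) (b w), M = negOuter v u} ∧
          (I = ∅ →
            clarke (fun X => lpValue I (c w) X (b w)) (A w) = convexHull ℝ
              {M | ∃ v ∈ dualSolutions I (c w) (A w) (b w),
                ∃ u ∈ primalSolutions I (c w) (A w) (b w), M = negOuter v u}) ∧
          (∀ v ∈ dualSolutions I (c w) (A w) (b w),
            ∀ u ∈ primalSolutions I (c w) (A w) (b w),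
              WithLp.toLp 2 (G₃.eval (Sum.elim v u)) = negOuter v u) ∧
          -- generalized gradients with respect to the parameter
          LipschitzNear P.value w ∧ (clarke P.value w).Nonempty ∧
          clarke P.value w ⊆ convexHull ℝ
            (⋃ u ∈ primalSolutions I (c w) (A w) (b w),
              ⋃ v ∈ dualSolutions I (c w) (A w) (b w),
                clarke (fun x => lagrangian (c x) (A x) (b x) u v) w) ∧
          ∀ (c' : Vec d →L[ℝ] Vec n) (A' : Vec d →L[ℝ] Mat m n) (b' : Vec d →L[ℝ] Vec m),
            HasStrictFDerivAt c c' w → HasStrictFDerivAt A A' w → HasStrictFDerivAt b b' w →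
            clarke P.value w ⊆ convexHull ℝ
              {g | ∃ u ∈ primalSolutions I (c w) (A w) (b w),
                ∃ v ∈ dualSolutions I (c w) (A w) (b w),
                  g = ContinuousLinearMap.adjoint c' u + ContinuousLinearMap.adjoint b' v
                    + ContinuousLinearMap.adjoint A' (negOuter v u)}) := by
  refine ⟨jacobianProgram d n, jacobianProgram d m, negOuterProgram m n, ?_, ?_, ?_,
    fun P w hw I => ⟨fun c A b h => ?_, fun c A b h => ?_, fun c A b h hst => ?_⟩⟩
  · rw [jacobianProgram, time_sumOfProducts]
    simp
    nlinarith
  · rw [jacobianProgram, time_sumOfProducts]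
    simp
    nlinarith
  · rw [negOuterProgram, time_sumOfProducts]
    simp
    nlinarith
  · obtain ⟨h1, h2, h3, h4⟩ := clarke_of_cost (h.cost_lipschitz w hw) (h.equivalent.eventually hw)
    refine ⟨h1, h2, h3, fun c' hc' => ⟨h4 c' hc', ?_⟩⟩
    simp only [eval_jacobianProgram]
    exact h4 c' hc'
  · obtain ⟨h1, h2, h3, h4⟩ := clarke_of_rhs (h.rhs_lipschitz w hw) (h.equivalent.eventually hw)
    refine ⟨h1, h2, h3, fun b' hb' => ⟨h4 b' hb', ?_⟩⟩
    simp only [eval_jacobianProgram]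
    exact h4 b' hb'
  · obtain ⟨h1, h2, h3⟩ := hst.clarke_mat_subset
    obtain ⟨h4, h5, h6⟩ := LPStable.clarke_subset (Z := P.value) (h.cost_lipschitz w hw)
      (h.mat_lipschitz w hw) (h.rhs_lipschitz w hw) hst
      -- As `w` is interior, the formulation is equivalent at all nearby parameters, so the value is
      -- `lpValue` around `w`.
      ((h.equivalent.eventually hw).mono fun x hx => hx.csInf_eq.symm)
    refine ⟨h1, h2, h3, ?_, fun v _ u _ => eval_negOuterProgram v u, h4, h5, h6,
      fun c' A' b' hc' hA' hb' => h6.trans (convexHull_mono ?_)⟩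
    · rintro rfl
      refine Set.Subset.antisymm h3 (convexHull_min ?_ (convex_convexHull ℝ _))
      rintro _ ⟨v, hv, u, hu, rfl⟩
      exact hst.negOuter_mem_clarke hu hv
    · refine Set.iUnion₂_subset fun u hu => Set.iUnion₂_subset fun v hv g hg => ?_
      exact ⟨u, hu, v, hv, clarke_lagrangian_subset hc' hA' hb' u v hg⟩
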